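/- Theorem 1.1. Let $p\ge 2$ be a real number and let $\Sigma^n$ be a complete non-compact Riemannian manifold (smooth, without boundary, with smooth metric) with $\lambda_{1,p}(\Sigma)=0$, where $$\lambda_{1,p}(\Sigma)=\inf\left\{\frac{\int_\Sigma|\nabla v|^p\,d\Sigma}{\int_\Sigma|v|^p\,d\Sigma}\;:\;v\in W^{1,p}_0(\Sigma)\setminus\{0\}\right\},$$ $d\Sigma$ is the Riemannian volume, and $W^{1,p}_0(\Sigma)$ is the closure of $C_c^\infty(\Sigma)$ in $W^{1,p}(\Sigma)$. Then every strongly $p$-subharmonic function on $\Sigma$ is unbounded: if $u:\Sigma\to\mathbb{R}$ is of class $C^2$ (in particular, if $u$ is smooth) and there is a constant $k>0$ such that $$\Delta_p u=\operatorname{div}\left(|\nabla u|^{p-2}\nabla u\right)\ge k\quad\text{everywhere on }\Sigma,$$ then $u$ is not bounded. -/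

import Mathlib

open scoped Manifold ContDiff ENNReal Topology
open MeasureTheory Filter Bundle

noncomputable section

namespace PLap

section Geometry

variable (n : ℕ) {M : Type*} [TopologicalSpace M]
  [ChartedSpace (EuclideanSpace ℝ (Fin n)) M]

/-- The value at the point with coordinates `z` of the `i`-th coordinate vector field `∂ᵢ` of the
preferred chart at `x`. -/
def coordField (x : M) (i : Fin n) (z : EuclideanSpace ℝ (Fin n)) :
    TangentSpace (𝓡 n) ((chartAt (EuclideanSpace ℝ (Fin n)) x).symm z) :=
  mfderiv (𝓡 n) (𝓡 n) (chartAt (EuclideanSpace ℝ (Fin n)) x).symm z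
    (EuclideanSpace.single i (1 : ℝ) : EuclideanSpace ℝ (Fin n))

/-- The `i`-th component, in the preferred chart at `x`, of the vector field `X` at the point
with coordinates `z`. -/
def coordComp (x : M) (X : ∀ y : M, TangentSpace (𝓡 n) y) (i : Fin n)
    (z : EuclideanSpace ℝ (Fin n)) : ℝ :=
  let v : EuclideanSpace ℝ (Fin n) :=
    mfderiv (𝓡 n) (𝓡 n) (chartAt (EuclideanSpace ℝ (Fin n)) x)
      ((chartAt (EuclideanSpace ℝ (Fin n)) x).symm z)
      (X ((chartAt (EuclideanSpace ℝ (Fin n)) x).symm z))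
  v i

variable [RiemannianBundle (fun x : M ↦ TangentSpace (𝓡 n) x)]

/-- The matrix `gᵢⱼ = ⟨∂ᵢ, ∂ⱼ⟩` of the metric in the preferred chart at `x`. -/
def metricMatrix (x : M) (z : EuclideanSpace ℝ (Fin n)) : Matrix (Fin n) (Fin n) ℝ :=
  Matrix.of fun i j ↦ inner ℝ (coordField n x i z) (coordField n x j z)

/-- The volume density `√(det gᵢⱼ)` in the preferred chart at `x`. -/
def volDensity (x : M) (z : EuclideanSpace ℝ (Fin n)) : ℝ :=
  √(metricMatrix n x z).det

/-- The divergence of a vector field, by the coordinate formula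
`div X = (det g)^(-1/2) ∑ᵢ ∂ᵢ ((det g)^(1/2) Xⁱ)`, in the preferred chart at `x`. -/
def divergence (X : ∀ y : M, TangentSpace (𝓡 n) y) (x : M) : ℝ :=
  (volDensity n x (chartAt (EuclideanSpace ℝ (Fin n)) x x))⁻¹ *
    ∑ i, fderiv ℝ (fun z ↦ volDensity n x z * coordComp n x X i z)
      (chartAt (EuclideanSpace ℝ (Fin n)) x x) (EuclideanSpace.single i (1 : ℝ))

/-- The tangent spaces are finite-dimensional, hence complete for the norm of the metric. -/
lemma completeSpace_tangentSpace (x : M) : CompleteSpace (TangentSpace (𝓡 n) x) := by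
  have : FiniteDimensional ℝ (TangentSpace (𝓡 n) x) :=
    inferInstanceAs (FiniteDimensional ℝ (EuclideanSpace ℝ (Fin n)))
  exact FiniteDimensional.complete ℝ _

/-- The Riemannian gradient: `⟨grad u, v⟩ = du (v)` for all tangent vectors `v`. -/
def grad (u : M → ℝ) (x : M) : TangentSpace (𝓡 n) x :=
  haveI := completeSpace_tangentSpace n x
  (InnerProductSpace.toDual ℝ (TangentSpace (𝓡 n) x)).symm
    (mvfderiv (𝓡 n) u x)

/-- The `p`-Laplacian `div (|∇u|^(p-2) ∇u)`, computed pointwise. -/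
def pLaplacian (p : ℝ) (u : M → ℝ) (x : M) : ℝ :=
  divergence n (fun y ↦ ‖grad n u y‖ ^ (p - 2) • grad n u y) x

/-- Strongly `p`-subharmonic functions: `Δ_p u ≥ k` for some constant `k > 0`. Two continuous
derivatives are what is needed for `Δ_p u` to make sense pointwise when `p ≥ 2`; smooth functions
are included. -/
def StronglyPSubharmonic (p : ℝ) (u : M → ℝ) : Prop :=
  ContMDiff (𝓡 n) 𝓘(ℝ, ℝ) 2 u ∧ ∃ k : ℝ, 0 < k ∧ ∀ x, k ≤ pLaplacian n p u x

variable [MeasurableSpace M]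

/-- The measure `√(det g) dz` of the preferred chart at `x`, transported to `M`. It is the
Riemannian volume restricted to the domain of the chart. -/
def chartVolume (x : M) : Measure M :=
  ((volume.restrict (chartAt (EuclideanSpace ℝ (Fin n)) x).target).withDensity
    fun z ↦ ENNReal.ofReal (volDensity n x z)).map (chartAt (EuclideanSpace ℝ (Fin n)) x).symm

variable (M) in
/-- The Riemannian volume measure: the least measure that dominates all the `chartVolume`s. These
agree on overlaps of charts, so on a second countable manifold this is the measure which on
each chart domain is given by `√(det g) dz`. -/
def riemVolume : Measure M := ⨆ x : M, chartVolume n x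

variable [IsManifold (𝓡 n) ∞ M]

/-- `G` is a weak gradient of `u`: `∫ u div X = - ∫ ⟨G, X⟩` for all smooth compactly supported
vector fields `X`. -/
def IsWeakGrad (u : M → ℝ) (G : ∀ x : M, TangentSpace (𝓡 n) x) : Prop :=
  ∀ X : ∀ x : M, TangentSpace (𝓡 n) x,
    ContMDiff (𝓡 n) (𝓡 n).tangent ∞ (fun x ↦ (⟨x, X x⟩ : TangentBundle (𝓡 n) M)) →
    (∃ K : Set M, IsCompact K ∧ ∀ x ∉ K, X x = 0) →
    ∫ x, u x * divergence n X x ∂riemVolume n M = -∫ x, inner ℝ (G x) (X x) ∂riemVolume n M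

/-- `u ∈ W^{1,p}(M)`, with weak gradient `G`. -/
structure MemW1p (p : ℝ) (u : M → ℝ) (G : ∀ x : M, TangentSpace (𝓡 n) x) : Prop where
  memLp : MemLp u (ENNReal.ofReal p) (riemVolume n M)
  aestronglyMeasurable_grad :
    AEStronglyMeasurable (fun x ↦ (⟨x, G x⟩ : TangentBundle (𝓡 n) M)) (riemVolume n M)
  lintegral_grad_lt_top : ∫⁻ x, ‖G x‖ₑ ^ p ∂riemVolume n M < ⊤
  isWeakGrad : IsWeakGrad n u G

/-- `u ∈ W₀^{1,p}(M)`, the closure of `C_c^∞(M)` in `W^{1,p}(M)`, with weak gradient `G`. -/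
def MemW01p (p : ℝ) (u : M → ℝ) (G : ∀ x : M, TangentSpace (𝓡 n) x) : Prop :=
  MemW1p n p u G ∧
    ∃ φ : ℕ → M → ℝ,
      (∀ k, ContMDiff (𝓡 n) 𝓘(ℝ, ℝ) ∞ (φ k) ∧ HasCompactSupport (φ k)) ∧
      Tendsto (fun k ↦ ∫⁻ x, ‖φ k x - u x‖ₑ ^ p ∂riemVolume n M +
        ∫⁻ x, ‖grad n (φ k) x - G x‖ₑ ^ p ∂riemVolume n M) atTop (𝓝 0)

variable (M) in
/-- The first eigenvalue `λ_{1,p}(M)` of the `p`-Laplacian: the infimum of the quotients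
`∫ |∇u|^p / ∫ |u|^p` over the `u ∈ W₀^{1,p}(M)` that are not almost everywhere zero. -/
def firstEigenvalue (p : ℝ) : ℝ≥0∞ :=
  ⨅ (u : M → ℝ) (G : ∀ x : M, TangentSpace (𝓡 n) x) (_ : MemW01p n p u G)
    (_ : ¬ u =ᵐ[riemVolume n M] 0),
    (∫⁻ x, ‖G x‖ₑ ^ p ∂riemVolume n M) / ∫⁻ x, ‖u x‖ₑ ^ p ∂riemVolume n M

end Geometry

end PLap

end

open scoped Manifold ContDiff ENNReal Topology
open MeasureTheory Filter Bundle

noncomputable section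

/-! A bounded strongly `p`-subharmonic function forces a Poincaré inequality, so the first
eigenvalue is positive. Let `|u| ≤ C` and `Δ_p u ≥ k > 0`, and test the latter against `|φ|^p e^u`
with `φ` compactly supported and `C^1`. Integrating by parts, the gradient of `e^u` contributes `-∫
e^u |φ|^p |∇u|^p`, and the gradient of `|φ|^p` contributes at most `p ∫ e^u |∇φ| (|φ| |∇u|)^(p-1)`.
Young's inequality splits the second into `p^p ∫ e^u |∇φ|^p` and a term that cancels the first.
Since `e^u` lies between `e^(-C)` and `e^C`, this gives `k e^(-C) ∫ |φ|^p ≤ p^p e^C ∫ |∇φ|^p`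
(`neg_inner_grad_rpow_mul_exp_le`, `mul_integral_abs_rpow_le`). Approximation carries the
inequality, with a worse constant, over to `W₀^{1,p}` (`lintegral_rpow_le_of_memW01p`).

Most of the work justifies the integration by parts. The flux `|∇u|^(p-2) ∇u` must be `C^1` even at
critical points of `u` (`contDiffOn_coordComp_rpow_grad`). The supremum defining the volume must be
`√(det g) dz` in every chart (`riemVolume_restrict_source`). The divergence, defined at each point
by that point's own chart, must not depend on the chart (`chartDivergence_eq_divergence`). A
partition of unity then yields `integral_mul_divergence`. -/

namespace PLap

/-! ### Calculus in a normed space: powers across zeros, integration by parts, matrix inverses. -/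

section Euclidean

variable {F : Type*} [NormedAddCommGroup F] [NormedSpace ℝ F]

/-- If `s ≥ 0` and `c` are `C^1` and both `c` and the derivative of `s` are locally `O(√s)`,
then `s ^ a * c` is `C^1` for every `a > 0`, also across the zeros of `s`. -/
theorem contDiffOn_rpow_mul {U : Set F} (hU : IsOpen U) {s c B : F → ℝ}
    (hs : ContDiffOn ℝ 1 s U) (hc : ContDiffOn ℝ 1 c U) (hB : ContinuousOn B U)
    (h0 : ∀ z ∈ U, 0 ≤ s z) (hcb : ∀ z ∈ U, |c z| ≤ B z * √(s z))
    (hsb : ∀ z ∈ U, ‖fderiv ℝ s z‖ ≤ B z * √(s z)) {a : ℝ} (ha : 0 < a) :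
    ContDiffOn ℝ 1 (fun z ↦ s z ^ a * c z) U := by
  set f' : F → F →L[ℝ] ℝ := fun z ↦ s z ^ a • fderiv ℝ c z +
    (a * s z ^ (a - 1) * c z) • fderiv ℝ s z with hf'
  have hsd : ∀ z ∈ U, HasFDerivAt s (fderiv ℝ s z) z := fun z hz ↦
    ((hs.contDiffAt (hU.mem_nhds hz)).differentiableAt one_ne_zero).hasFDerivAt
  have hcd : ∀ z ∈ U, HasFDerivAt c (fderiv ℝ c z) z := fun z hz ↦
    ((hc.contDiffAt (hU.mem_nhds hz)).differentiableAt one_ne_zero).hasFDerivAt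
  have hs'c : ContinuousOn (fderiv ℝ s) U := hs.continuousOn_fderiv_of_isOpen hU le_rfl
  have hc'c : ContinuousOn (fderiv ℝ c) U := hc.continuousOn_fderiv_of_isOpen hU le_rfl
  have hsa : ContinuousOn (fun z ↦ s z ^ a) U :=
    hs.continuousOn.rpow_const fun z _ ↦ Or.inr ha.le
  have hcz : ∀ z ∈ U, s z = 0 → c z = 0 := fun z hz h ↦ by
    simpa [h] using hcb z hz
  have hder : ∀ z ∈ U, HasFDerivAt (fun z ↦ s z ^ a * c z) (f' z) z := by
    intro z hz
    rcases (h0 z hz).eq_or_lt with h | h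
    · have hc0 := hcz z hz h.symm
      have hf0 : f' z = 0 := by
        simp [hf', hc0, ← h, Real.zero_rpow ha.ne']
      rw [hf0]
      -- At a zero of `s`, `c` is `O(|y - z|)` and `s ^ a` tends to `0`, so the product is `o(|y -
      -- z|)` and its derivative is `0`.
      have hcO : c =O[𝓝 z] fun y ↦ y - z := by
        simpa [hc0] using (hcd z hz).isBigO_sub
      have hso : (fun y ↦ s y ^ a) =o[𝓝 z] fun _ ↦ (1 : ℝ) := by
        rw [Asymptotics.isLittleO_one_iff]
        have := (hsa.continuousAt (hU.mem_nhds hz)).tendsto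
        simpa [← h, Real.zero_rpow ha.ne'] using this
      have := hso.mul_isBigO hcO.norm_right
      rw [hasFDerivAt_iff_isLittleO]
      simpa [hc0] using this
    · have h1 := (hsd z hz).rpow_const (p := a) (Or.inl h.ne')
      refine (h1.fun_mul (hcd z hz)).congr_fderiv ?_
      ext v
      simp only [hf', add_apply, smul_apply, smul_eq_mul]
      ring
  have hcont : ContinuousOn f' U := by
    intro z hz
    apply ContinuousAt.continuousWithinAt
    have hzU := hU.mem_nhds hz
    have c1 := (hsa.smul hc'c).continuousAt hzU
    rcases (h0 z hz).eq_or_lt with h | h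
    · have hc0 := hcz z hz h.symm
      have hf0 : f' z = 0 := by
        simp [hf', hc0, ← h, Real.zero_rpow ha.ne']
      unfold ContinuousAt
      rw [hf0]
      -- The factor `s ^ (a - 1)` may blow up, but `c` and `fderiv ℝ s` each supply a factor `√s`,
      -- so the second term of `f'` is at most `a B² s ^ a`.
      have hb : ∀ y ∈ U, ‖f' y‖ ≤ s y ^ a * ‖fderiv ℝ c y‖ + a * (B y * B y) * s y ^ a := by
        intro y hy
        have hsa0 : 0 ≤ s y ^ a := Real.rpow_nonneg (h0 y hy) _
        refine (norm_add_le _ _).trans (add_le_add ?_ ?_)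
        · rw [norm_smul, Real.norm_of_nonneg hsa0]
        · rw [norm_smul]
          rcases (h0 y hy).eq_or_lt with h' | h'
          · rw [hcz y hy h'.symm, ← h', Real.zero_rpow ha.ne']
            simp
          · have e1 : ‖a * s y ^ (a - 1) * c y‖ ≤ a * s y ^ (a - 1) * (B y * √(s y)) := by
              rw [norm_mul, Real.norm_of_nonneg (by positivity), Real.norm_eq_abs]
              gcongr
              exact hcb y hy
            refine (mul_le_mul e1 (hsb y hy) (norm_nonneg _)
              ((norm_nonneg _).trans e1)).trans (le_of_eq ?_)
            have e2 : s y ^ a = s y ^ (a - 1) * s y := by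
              rw [Real.rpow_sub_one h'.ne']; field_simp
            rw [e2]
            have e3 := Real.mul_self_sqrt h'.le
            calc _ = a * (B y * B y) * (s y ^ (a - 1) * (√(s y) * √(s y))) := by ring
              _ = _ := by rw [e3]
      have hlim : Tendsto (fun y ↦ s y ^ a * ‖fderiv ℝ c y‖ + a * (B y * B y) * s y ^ a)
          (𝓝 z) (𝓝 0) := by
        have := (((hsa.fun_mul hc'c.norm).fun_add
          ((continuousOn_const (c := a)).fun_mul (hB.fun_mul hB) |>.fun_mul
            hsa)).continuousAt hzU).tendsto
        simpa [← h, Real.zero_rpow ha.ne'] using this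
      exact squeeze_zero_norm' (by filter_upwards [hzU] with y hy using hb y hy) hlim
    · refine ContinuousAt.fun_add c1 (ContinuousAt.fun_smul ?_ (hs'c.continuousAt hzU))
      have := hs.continuousOn.continuousAt hzU
      exact (continuousAt_const.fun_mul (this.rpow_const (Or.inl h.ne'))).fun_mul
        (hc.continuousOn.continuousAt hzU)
  rw [show (1 : ℕ∞ω) = 0 + 1 by simp, contDiffOn_succ_iff_fderiv_of_isOpen hU]
  refine ⟨fun z hz ↦ (hder z hz).differentiableAt.differentiableWithinAt, by simp, ?_⟩
  rw [contDiffOn_zero]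
  exact hcont.congr fun z hz ↦ (hder z hz).fderiv


theorem integrableOn_of_eq_zero_off_compact {X : Type*} [TopologicalSpace X] [T2Space X]
    [MeasurableSpace X] [BorelSpace X] {μ : Measure X} [IsFiniteMeasureOnCompacts μ]
    {U K : Set X} (hU : MeasurableSet U) {f : X → ℝ}
    (hf : ContinuousOn f U) (hK : IsCompact K) (hKU : K ⊆ U) (h0 : ∀ z ∈ U \ K, f z = 0) :
    IntegrableOn f U μ :=
  ((hf.mono hKU).integrableOn_compact hK).of_forall_sdiff_eq_zero hU h0

/-- Since `w` vanishes off a compact subset of `U`, the product `w * Y` extends by zero to a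
compactly supported `C^1` function on the whole space, even though `Y` may be irregular outside `U`.
The integral of its directional derivative is zero. -/
theorem integral_mul_fderiv_eq_neg_of_eq_zero_off_compact [FiniteDimensional ℝ F]
    [MeasurableSpace F] [BorelSpace F] {μ : Measure F} [μ.IsAddHaarMeasure] {U K : Set F} (hU : IsOpen U) {w Y : F → ℝ}
    (hw : ContDiffOn ℝ 1 w U) (hY : ContDiffOn ℝ 1 Y U) (hK : IsCompact K) (hKU : K ⊆ U)
    (h0 : ∀ z ∈ U \ K, w z = 0) (v : F) :
    ∫ z in U, w z * fderiv ℝ Y z v ∂μ = -∫ z in U, fderiv ℝ w z v * Y z ∂μ := by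
  have hw' : ∀ z ∈ U \ K, fderiv ℝ w z = 0 := by
    intro z hz
    have : w =ᶠ[𝓝 z] fun _ ↦ 0 := by
      filter_upwards [(hU.sdiff hK.isClosed).mem_nhds hz] with y hy using h0 y hy
    rw [this.fderiv_eq]; simp
  have hwc := hw.continuousOn_fderiv_of_isOpen hU le_rfl
  have hYc := hY.continuousOn_fderiv_of_isOpen hU le_rfl
  have i1 : IntegrableOn (fun z ↦ w z * fderiv ℝ Y z v) U μ :=
    integrableOn_of_eq_zero_off_compact hU.measurableSet
      (hw.continuousOn.mul (hYc.clm_apply continuousOn_const)) hK hKU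
      (fun z hz ↦ by simp [h0 z hz])
  have i2 : IntegrableOn (fun z ↦ fderiv ℝ w z v * Y z) U μ :=
    integrableOn_of_eq_zero_off_compact hU.measurableSet
      ((hwc.clm_apply continuousOn_const).mul hY.continuousOn) hK hKU
      (fun z hz ↦ by simp [hw' z hz])
  set f : F → ℝ := U.indicator fun z ↦ w z * Y z with hf
  have hfU : ∀ z ∈ U, f =ᶠ[𝓝 z] fun z ↦ w z * Y z := fun z hz ↦ by
    filter_upwards [hU.mem_nhds hz] with y hy
    simp [hf, hy]
  have hfK : ∀ z ∉ K, f =ᶠ[𝓝 z] fun _ ↦ 0 := fun z hz ↦ by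
    filter_upwards [hK.isClosed.isOpen_compl.mem_nhds hz] with y hy
    by_cases hyU : y ∈ U
    · simp [hf, hyU, h0 y ⟨hyU, hy⟩]
    · simp [hf, hyU]
  have hfd : ContDiff ℝ 1 f := by
    rw [contDiff_iff_contDiffAt]
    intro z
    by_cases hz : z ∈ K
    · exact (((hw.mul hY).contDiffAt (hU.mem_nhds (hKU hz)))).congr_of_eventuallyEq
        (hfU z (hKU hz))
    · exact contDiffAt_const.congr_of_eventuallyEq (hfK z hz)
  have hfs : HasCompactSupport f := HasCompactSupport.intro hK fun z hz ↦ (hfK z hz).self_of_nhds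
  have key : ∫ z, fderiv ℝ f z v ∂μ = 0 := by
    -- Integration by parts against the constant `1`.
    have := integral_mul_fderiv_eq_neg_fderiv_mul_of_integrable (μ := μ) (f := fun _ : F ↦ (1 : ℝ))
      (g := f) (v := v) (by simp) ?_ ?_ (by simp) fun z _ ↦ hfd.differentiable one_ne_zero z
    · simpa using this
    · simp only [one_mul]
      exact ((hfd.continuous_fderiv one_ne_zero).clm_apply
        continuous_const).integrable_of_hasCompactSupport (hfs.fderiv_apply ℝ v)
    · simpa using hfd.continuous.integrable_of_hasCompactSupport hfs
  have key2 : ∫ z, fderiv ℝ f z v ∂μ = ∫ z in U, fderiv ℝ f z v ∂μ := by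
    symm
    apply setIntegral_eq_integral_of_forall_compl_eq_zero
    intro z hz
    rw [(hfK z fun h ↦ hz (hKU h)).fderiv_eq]; simp
  have key3 : ∫ z in U, fderiv ℝ f z v ∂μ =
      ∫ z in U, (w z * fderiv ℝ Y z v + fderiv ℝ w z v * Y z) ∂μ := by
    apply setIntegral_congr_fun hU.measurableSet
    intro z hz
    have d1 := ((hw.contDiffAt (hU.mem_nhds hz)).differentiableAt one_ne_zero)
    have d2 := ((hY.contDiffAt (hU.mem_nhds hz)).differentiableAt one_ne_zero)
    simp only
    rw [(hfU z hz).fderiv_eq, fderiv_fun_mul d1 d2]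
    simp [mul_comm]
  rw [integral_add i1 i2] at key3
  linarith

theorem contDiffOn_det {ι : Type*} [Fintype ι] [DecidableEq ι] {m : ℕ∞ω} {U : Set F}
    {A : F → Matrix ι ι ℝ} (hA : ∀ i j, ContDiffOn ℝ m (fun z ↦ A z i j) U) :
    ContDiffOn ℝ m (fun z ↦ (A z).det) U := by
  simp only [Matrix.det_apply']
  exact ContDiffOn.sum fun σ _ ↦ contDiffOn_const.mul (contDiffOn_prod fun i _ ↦ hA _ _)

/-- Cramer's rule: an entry of the inverse is the reciprocal determinant times the determinant of
the matrix with one row replaced by a constant. -/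
theorem contDiffOn_matrix_inv {ι : Type*} [Fintype ι] [DecidableEq ι] {m : ℕ∞ω} {U : Set F}
    {A : F → Matrix ι ι ℝ} (hA : ∀ i j, ContDiffOn ℝ m (fun z ↦ A z i j) U)
    (hdet : ∀ z ∈ U, (A z).det ≠ 0) (i j : ι) :
    ContDiffOn ℝ m (fun z ↦ (A z)⁻¹ i j) U := by
  simp only [Matrix.inv_def, Matrix.smul_apply, Ring.inverse_eq_inv', Matrix.adjugate_apply,
    smul_eq_mul]
  refine ((contDiffOn_det hA).inv hdet).mul (contDiffOn_det fun k l ↦ ?_)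
  by_cases h : k = j
  · subst h; simpa using contDiffOn_const
  · simpa [Matrix.updateRow_ne h] using hA k l

end Euclidean

/-! ### Coordinate vector fields and smoothness of the metric in a chart. -/

section ChartGeometry

variable {n : ℕ} {M : Type*} [TopologicalSpace M]
  [ChartedSpace (EuclideanSpace ℝ (Fin n)) M]

theorem mfderiv_symm_eq_sum (x : M) (z v : EuclideanSpace ℝ (Fin n)) :
    (mfderiv (𝓡 n) (𝓡 n) (chartAt (EuclideanSpace ℝ (Fin n)) x).symm z v :
      TangentSpace (𝓡 n) ((chartAt (EuclideanSpace ℝ (Fin n)) x).symm z)) =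
      ∑ j, v j • coordField n x j z := by
  have hv : v = ∑ j, v j • EuclideanSpace.single j (1 : ℝ) := by
    ext i; simp [Pi.single_apply]
  let L : EuclideanSpace ℝ (Fin n) →L[ℝ]
    TangentSpace (𝓡 n) ((chartAt (EuclideanSpace ℝ (Fin n)) x).symm z) :=
    mfderiv (𝓡 n) (𝓡 n) (chartAt (EuclideanSpace ℝ (Fin n)) x).symm z
  change L v = ∑ j, v j • L (EuclideanSpace.single j (1 : ℝ))
  conv_lhs => rw [hv]
  simp only [map_sum, map_smul]

variable [IsManifold (𝓡 n) ∞ M]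

theorem mdifferentiable_chartAt (x : M) :
    (chartAt (EuclideanSpace ℝ (Fin n)) x).MDifferentiable (𝓡 n) (𝓡 n) :=
  have : IsManifold (𝓡 n) 1 M := IsManifold.of_le (n := ∞) (by simp)
  mdifferentiable_chart x

theorem mfderiv_chart_mfderiv_symm (x : M) {z : EuclideanSpace ℝ (Fin n)}
    (hz : z ∈ (chartAt (EuclideanSpace ℝ (Fin n)) x).target) (v : TangentSpace (𝓡 n) z) :
    mfderiv (𝓡 n) (𝓡 n) (chartAt (EuclideanSpace ℝ (Fin n)) x)
      ((chartAt (EuclideanSpace ℝ (Fin n)) x).symm z)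
      (mfderiv (𝓡 n) (𝓡 n) (chartAt (EuclideanSpace ℝ (Fin n)) x).symm z v) = v :=
  DFunLike.congr_fun ((mdifferentiable_chartAt x).comp_symm_deriv hz) v

theorem mfderiv_symm_mfderiv_chart (x : M) {z : EuclideanSpace ℝ (Fin n)}
    (hz : z ∈ (chartAt (EuclideanSpace ℝ (Fin n)) x).target)
    (v : TangentSpace (𝓡 n) ((chartAt (EuclideanSpace ℝ (Fin n)) x).symm z)) :
    mfderiv (𝓡 n) (𝓡 n) (chartAt (EuclideanSpace ℝ (Fin n)) x).symm z
      (mfderiv (𝓡 n) (𝓡 n) (chartAt (EuclideanSpace ℝ (Fin n)) x)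
      ((chartAt (EuclideanSpace ℝ (Fin n)) x).symm z) v) = v := by
  have h := (mdifferentiable_chartAt x).symm_comp_deriv
    ((chartAt (EuclideanSpace ℝ (Fin n)) x).map_target hz)
  -- `symm_comp_deriv` differentiates at `φ (φ.symm z)`, which is only propositionally `z`. Viewing
  -- all tangent spaces as the model space allows the base point to be replaced.
  have h1 : ∀ y, y = z → ((mfderiv (𝓡 n) (𝓡 n) (chartAt (EuclideanSpace ℝ (Fin n)) x).symm y :
      EuclideanSpace ℝ (Fin n) →L[ℝ] EuclideanSpace ℝ (Fin n)) =
      (mfderiv (𝓡 n) (𝓡 n) (chartAt (EuclideanSpace ℝ (Fin n)) x).symm z :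
      EuclideanSpace ℝ (Fin n) →L[ℝ] EuclideanSpace ℝ (Fin n))) := by
    rintro y rfl
    rfl
  have h2 := h1 _ ((chartAt (EuclideanSpace ℝ (Fin n)) x).right_inv hz)
  exact (DFunLike.congr_fun h2 _).symm.trans (DFunLike.congr_fun h v)

theorem eq_sum_coordComp (x : M) (X : ∀ y : M, TangentSpace (𝓡 n) y)
    {z : EuclideanSpace ℝ (Fin n)}
    (hz : z ∈ (chartAt (EuclideanSpace ℝ (Fin n)) x).target) :
    X ((chartAt (EuclideanSpace ℝ (Fin n)) x).symm z) =
      ∑ j, coordComp n x X j z • coordField n x j z := by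
  have := mfderiv_symm_eq_sum x z (mfderiv (𝓡 n) (𝓡 n) (chartAt (EuclideanSpace ℝ (Fin n)) x)
      ((chartAt (EuclideanSpace ℝ (Fin n)) x).symm z)
      (X ((chartAt (EuclideanSpace ℝ (Fin n)) x).symm z)))
  exact (mfderiv_symm_mfderiv_chart x hz _).symm.trans this

theorem linearIndependent_coordField (x : M) {z : EuclideanSpace ℝ (Fin n)}
    (hz : z ∈ (chartAt (EuclideanSpace ℝ (Fin n)) x).target) :
    LinearIndependent ℝ fun i ↦ coordField n x i z := by
  rw [Fintype.linearIndependent_iff]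
  intro g hg i
  have h := mfderiv_symm_eq_sum x z (WithLp.toLp 2 g)
  have h2 := mfderiv_chart_mfderiv_symm x hz (WithLp.toLp 2 g : EuclideanSpace ℝ (Fin n))
  rw [h] at h2
  have h3 : (WithLp.toLp 2 g : EuclideanSpace ℝ (Fin n)) = 0 := by
    rw [← h2]
    simp only []
    erw [hg]
    exact map_zero _
  simpa using congrArg (fun w : EuclideanSpace ℝ (Fin n) ↦ w i) h3

/-- The coordinate field is the tangent map of the inverse chart applied to a constant section of
the tangent bundle of the model space. -/
theorem contMDiffOn_coordField (x : M) (i : Fin n) :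
    ContMDiffOn (𝓡 n) (𝓡 n).tangent ∞
      (fun z ↦ (⟨(chartAt (EuclideanSpace ℝ (Fin n)) x).symm z, coordField n x i z⟩ :
        TangentBundle (𝓡 n) M)) (chartAt (EuclideanSpace ℝ (Fin n)) x).target := by
  have : IsManifold (𝓡 n) 1 M := IsManifold.of_le (n := ∞) (by simp)
  have hopen := (chartAt (EuclideanSpace ℝ (Fin n)) x).open_target
  have h1 := (contMDiffOn_chart_symm (I := 𝓡 n) (n := ∞) (x := x)).contMDiffOn_tangentMapWithin
    (m := ∞) (by simp) hopen.uniqueMDiffOn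
  have h2 : ContMDiff (𝓡 n) (𝓡 n).tangent ∞ (fun z : EuclideanSpace ℝ (Fin n) ↦
      (tangentBundleModelSpaceHomeomorph (𝓡 n)).symm (z, EuclideanSpace.single i (1 : ℝ))) := by
    refine contMDiff_tangentBundleModelSpaceHomeomorph_symm.comp ?_
    have h := contMDiff_id.prodMk (n := ∞) (I := 𝓡 n) (contMDiff_const (I := 𝓡 n) (M := EuclideanSpace ℝ (Fin n))
      (I' := 𝓡 n) (c := (EuclideanSpace.single i (1 : ℝ) : EuclideanSpace ℝ (Fin n))))
    rw [chartedSpaceSelf_prod] at h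
    exact h
  refine (h1.comp h2.contMDiffOn fun z hz ↦ ?_).congr fun z hz ↦ ?_
  · exact hz
  · have h3 := mfderivWithin_of_isOpen (I := 𝓡 n) (I' := 𝓡 n)
      (f := (chartAt (EuclideanSpace ℝ (Fin n)) x).symm) hopen hz
    exact congrArg (fun L : EuclideanSpace ℝ (Fin n) →L[ℝ] EuclideanSpace ℝ (Fin n) ↦
      (⟨(chartAt (EuclideanSpace ℝ (Fin n)) x).symm z, L (EuclideanSpace.single i (1 : ℝ))⟩ :
        TangentBundle (𝓡 n) M)) h3.symm

variable [RiemannianBundle (fun x : M ↦ TangentSpace (𝓡 n) x)]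

theorem metricMatrix_posDef (x : M) {z : EuclideanSpace ℝ (Fin n)}
    (hz : z ∈ (chartAt (EuclideanSpace ℝ (Fin n)) x).target) :
    (metricMatrix n x z).PosDef :=
  Matrix.posDef_gram_of_linearIndependent (linearIndependent_coordField x hz)

theorem volDensity_pos (x : M) {z : EuclideanSpace ℝ (Fin n)}
    (hz : z ∈ (chartAt (EuclideanSpace ℝ (Fin n)) x).target) : 0 < volDensity n x z :=
  Real.sqrt_pos.2 (metricMatrix_posDef x hz).det_pos

variable [IsContMDiffRiemannianBundle (𝓡 n) ∞ (EuclideanSpace ℝ (Fin n))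
      (fun x : M ↦ TangentSpace (𝓡 n) x)]

theorem contDiffOn_metricMatrix (x : M) (i j : Fin n) :
    ContDiffOn ℝ ∞ (fun z ↦ metricMatrix n x z i j)
      (chartAt (EuclideanSpace ℝ (Fin n)) x).target := by
  rw [← contMDiffOn_iff_contDiffOn]
  exact ContMDiffOn.inner_bundle (contMDiffOn_coordField x i) (contMDiffOn_coordField x j)

theorem contDiffOn_volDensity (x : M) :
    ContDiffOn ℝ ∞ (volDensity n x) (chartAt (EuclideanSpace ℝ (Fin n)) x).target :=
  (contDiffOn_det (contDiffOn_metricMatrix x)).sqrt fun _ hz ↦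
    (metricMatrix_posDef x hz).det_pos.ne'

end ChartGeometry

/-! ### The gradient in coordinates and regularity of the `p`-Laplacian flux. -/

section Gradient

variable {n : ℕ} {M : Type*} [TopologicalSpace M]
  [ChartedSpace (EuclideanSpace ℝ (Fin n)) M]

/-- The `i`-th partial derivative of `u` in the preferred chart at `x`. -/
def coordDeriv (x : M) (u : M → ℝ) (i : Fin n) (z : EuclideanSpace ℝ (Fin n)) : ℝ :=
  fderiv ℝ (u ∘ (chartAt (EuclideanSpace ℝ (Fin n)) x).symm) z (EuclideanSpace.single i (1 : ℝ))

theorem coordComp_smul (x : M) (f : M → ℝ) (X : ∀ y : M, TangentSpace (𝓡 n) y) (i : Fin n)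
    (z : EuclideanSpace ℝ (Fin n)) :
    coordComp n x (fun y ↦ f y • X y) i z =
      f ((chartAt (EuclideanSpace ℝ (Fin n)) x).symm z) * coordComp n x X i z := by
  let L : EuclideanSpace ℝ (Fin n) →L[ℝ] EuclideanSpace ℝ (Fin n) :=
    mfderiv (𝓡 n) (𝓡 n) (chartAt (EuclideanSpace ℝ (Fin n)) x)
      ((chartAt (EuclideanSpace ℝ (Fin n)) x).symm z)
  have := L.map_smul (f ((chartAt (EuclideanSpace ℝ (Fin n)) x).symm z))
    (X ((chartAt (EuclideanSpace ℝ (Fin n)) x).symm z))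
  exact congrArg (fun w : EuclideanSpace ℝ (Fin n) ↦ w i) this

theorem inner_grad [RiemannianBundle (fun x : M ↦ TangentSpace (𝓡 n) x)] (u : M → ℝ) (y : M) (v : TangentSpace (𝓡 n) y) :
    inner ℝ (grad n u y) v = mvfderiv (𝓡 n) u y v := by
  have := completeSpace_tangentSpace n y
  exact InnerProductSpace.toDual_symm_apply

variable [IsManifold (𝓡 n) ∞ M]

theorem contDiffOn_comp_chart_symm {m : ℕ∞} (x : M) {u : M → ℝ}
    (hu : ContMDiff (𝓡 n) 𝓘(ℝ, ℝ) m u) :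
    ContDiffOn ℝ m (u ∘ (chartAt (EuclideanSpace ℝ (Fin n)) x).symm)
      (chartAt (EuclideanSpace ℝ (Fin n)) x).target := by
  have : IsManifold (𝓡 n) m M := IsManifold.of_le (n := ∞) (by exact_mod_cast le_top)
  rw [← contMDiffOn_iff_contDiffOn]
  exact hu.comp_contMDiffOn contMDiffOn_chart_symm

theorem contDiffOn_coordDeriv {m m' : ℕ∞} (x : M) {u : M → ℝ}
    (hu : ContMDiff (𝓡 n) 𝓘(ℝ, ℝ) m u) (h : m' + 1 ≤ m) (i : Fin n) :
    ContDiffOn ℝ m' (coordDeriv x u i) (chartAt (EuclideanSpace ℝ (Fin n)) x).target :=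
  ((contDiffOn_comp_chart_symm x hu).fderiv_of_isOpen
    (chartAt (EuclideanSpace ℝ (Fin n)) x).open_target (by exact_mod_cast h)).clm_apply
      contDiffOn_const

theorem mvfderiv_coordField (x : M) {u : M → ℝ} {z : EuclideanSpace ℝ (Fin n)}
    (hz : z ∈ (chartAt (EuclideanSpace ℝ (Fin n)) x).target)
    (hu : MDifferentiableAt (𝓡 n) 𝓘(ℝ, ℝ) u ((chartAt (EuclideanSpace ℝ (Fin n)) x).symm z))
    (i : Fin n) :
    mvfderiv (𝓡 n) u ((chartAt (EuclideanSpace ℝ (Fin n)) x).symm z) (coordField n x i z) =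
      coordDeriv x u i z := by
  have h := mvfderiv_comp_apply z hu ((mdifferentiable_chartAt x).mdifferentiableAt_symm hz)
    (EuclideanSpace.single i (1 : ℝ) : EuclideanSpace ℝ (Fin n))
  refine h.symm.trans ?_
  unfold coordDeriv mvfderiv
  rw [mfderiv_eq_fderiv]
  rfl

variable [RiemannianBundle (fun x : M ↦ TangentSpace (𝓡 n) x)]

theorem inner_grad_coordField (x : M) {u : M → ℝ} {z : EuclideanSpace ℝ (Fin n)}
    (hz : z ∈ (chartAt (EuclideanSpace ℝ (Fin n)) x).target)
    (hu : MDifferentiableAt (𝓡 n) 𝓘(ℝ, ℝ) u ((chartAt (EuclideanSpace ℝ (Fin n)) x).symm z))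
    (i : Fin n) :
    inner ℝ (grad n u ((chartAt (EuclideanSpace ℝ (Fin n)) x).symm z)) (coordField n x i z) =
      coordDeriv x u i z := by
  rw [inner_grad, mvfderiv_coordField x hz hu]

theorem inner_grad_eq_sum (x : M) {u : M → ℝ} {z : EuclideanSpace ℝ (Fin n)}
    (hz : z ∈ (chartAt (EuclideanSpace ℝ (Fin n)) x).target)
    (hu : MDifferentiableAt (𝓡 n) 𝓘(ℝ, ℝ) u ((chartAt (EuclideanSpace ℝ (Fin n)) x).symm z))
    (X : ∀ y : M, TangentSpace (𝓡 n) y) :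
    inner ℝ (grad n u ((chartAt (EuclideanSpace ℝ (Fin n)) x).symm z))
      (X ((chartAt (EuclideanSpace ℝ (Fin n)) x).symm z)) =
      ∑ j, coordDeriv x u j z * coordComp n x X j z := by
  rw [eq_sum_coordComp x X hz, inner_sum]
  refine Finset.sum_congr rfl fun j _ ↦ ?_
  rw [real_inner_smul_right, inner_grad_coordField x hz hu, mul_comm]

/-- Pairing the gradient with each `∂ᵢ` gives a linear system with matrix `gᵢⱼ`; inverting it raises
the index. -/
theorem coordComp_grad (x : M) {u : M → ℝ} {z : EuclideanSpace ℝ (Fin n)}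
    (hz : z ∈ (chartAt (EuclideanSpace ℝ (Fin n)) x).target)
    (hu : MDifferentiableAt (𝓡 n) 𝓘(ℝ, ℝ) u ((chartAt (EuclideanSpace ℝ (Fin n)) x).symm z))
    (j : Fin n) :
    coordComp n x (grad n u) j z = ∑ i, (metricMatrix n x z)⁻¹ j i * coordDeriv x u i z := by
  have hdet := (metricMatrix_posDef x hz).det_pos.ne'
  have h1 : (metricMatrix n x z).mulVec (fun j ↦ coordComp n x (grad n u) j z) =
      fun i ↦ coordDeriv x u i z := by
    ext i
    change ∑ j, metricMatrix n x z i j * coordComp n x (grad n u) j z = _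
    rw [← inner_grad_coordField x hz hu, eq_sum_coordComp x (grad n u) hz, sum_inner]
    refine Finset.sum_congr rfl fun j _ ↦ ?_
    rw [real_inner_smul_left, real_inner_comm, mul_comm]
    rfl
  have h2 := congrArg ((metricMatrix n x z)⁻¹).mulVec h1
  rw [Matrix.mulVec_mulVec, Matrix.nonsing_inv_mul _ (isUnit_iff_ne_zero.2 hdet),
    Matrix.one_mulVec] at h2
  exact congrFun h2 j

variable [IsContMDiffRiemannianBundle (𝓡 n) ∞ (EuclideanSpace ℝ (Fin n))
      (fun x : M ↦ TangentSpace (𝓡 n) x)]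

theorem contDiffOn_coordComp_grad {m m' : ℕ∞} (x : M) {u : M → ℝ}
    (hu : ContMDiff (𝓡 n) 𝓘(ℝ, ℝ) m u) (h : m' + 1 ≤ m) (j : Fin n) :
    ContDiffOn ℝ m' (coordComp n x (grad n u) j)
      (chartAt (EuclideanSpace ℝ (Fin n)) x).target := by
  have hm : m ≠ 0 := by
    rintro rfl
    simp at h
  refine ContDiffOn.congr (ContDiffOn.sum fun i _ ↦
    ((contDiffOn_matrix_inv (contDiffOn_metricMatrix x)
      (fun z hz ↦ (metricMatrix_posDef x hz).det_pos.ne') j i).of_le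
        (by exact_mod_cast le_top)).mul (contDiffOn_coordDeriv x hu h i)) fun z hz ↦
    coordComp_grad x hz (hu.mdifferentiable (by exact_mod_cast hm) _) j

/-- The factor `|∇u|^(p-2)` need not be differentiable at critical points, but the flux is `s ^
((p-2)/2)` times a gradient component, with `s = |∇u|²`. Both that component and the derivative of
`s` are locally `O(√s)`, which is what `contDiffOn_rpow_mul` requires. -/
theorem contDiffOn_coordComp_rpow_grad {p : ℝ} (hp : 2 ≤ p) (x : M) {u : M → ℝ}
    (hu : ContMDiff (𝓡 n) 𝓘(ℝ, ℝ) 2 u) (j : Fin n) :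
    ContDiffOn ℝ 1 (coordComp n x (fun y ↦ ‖grad n u y‖ ^ (p - 2) • grad n u y) j)
      (chartAt (EuclideanSpace ℝ (Fin n)) x).target := by
  set U := (chartAt (EuclideanSpace ℝ (Fin n)) x).target
  have hUo : IsOpen U := (chartAt (EuclideanSpace ℝ (Fin n)) x).open_target
  set ψ := (chartAt (EuclideanSpace ℝ (Fin n)) x).symm
  have hX : ∀ i, ContDiffOn ℝ 1 (coordComp n x (grad n u) i) U := fun i ↦
    contDiffOn_coordComp_grad (m := 2) (m' := 1) x hu (by norm_num) i
  have ha : ∀ i, ContDiffOn ℝ 1 (coordDeriv x u i) U := fun i ↦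
    contDiffOn_coordDeriv (m := 2) (m' := 1) x hu (by norm_num) i
  have hud : ∀ y, MDifferentiableAt (𝓡 n) 𝓘(ℝ, ℝ) u y := fun y ↦
    hu.mdifferentiable (by simp) y
  -- For `p = 2` the exponent `(p - 2) / 2` is `0`, outside the range of `contDiffOn_rpow_mul`, and
  -- the flux is the gradient itself.
  rcases hp.eq_or_lt with rfl | hp
  · refine (hX j).congr fun z _ ↦ ?_
    rw [coordComp_smul]; simp
  set s : EuclideanSpace ℝ (Fin n) → ℝ := fun z ↦ ∑ i, coordDeriv x u i z *
    coordComp n x (grad n u) i z with hs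
  have hsn : ∀ z ∈ U, s z = ‖grad n u (ψ z)‖ ^ 2 := fun z hz ↦ by
    rw [hs, ← real_inner_self_eq_norm_sq, inner_grad_eq_sum x hz (hud _)]
  have hsq : ∀ z ∈ U, √(s z) = ‖grad n u (ψ z)‖ := fun z hz ↦ by
    rw [hsn z hz, Real.sqrt_sq (norm_nonneg _)]
  set A : Fin n → EuclideanSpace ℝ (Fin n) → ℝ := fun i z ↦ √(metricMatrix n x z i i) with hA
  -- Cauchy–Schwarz, with `A i` the length of `∂ᵢ`.
  have hab : ∀ i, ∀ z ∈ U, |coordDeriv x u i z| ≤ A i z * √(s z) := fun i z hz ↦ by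
    rw [← inner_grad_coordField x hz (hud _), hsq z hz, mul_comm]
    refine (abs_real_inner_le_norm _ _).trans_eq ?_
    simp only [hA, metricMatrix, Matrix.of_apply]
    rw [real_inner_self_eq_norm_sq, Real.sqrt_sq (norm_nonneg _)]
  set C : Fin n → EuclideanSpace ℝ (Fin n) → ℝ := fun k z ↦
    ∑ i, |(metricMatrix n x z)⁻¹ k i| * A i z with hC
  have hXb : ∀ k, ∀ z ∈ U, |coordComp n x (grad n u) k z| ≤ C k z * √(s z) := fun k z hz ↦ by
    rw [coordComp_grad x hz (hud _), hC, Finset.sum_mul]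
    refine (Finset.abs_sum_le_sum_abs _ _).trans (Finset.sum_le_sum fun i _ ↦ ?_)
    rw [abs_mul, mul_assoc]
    exact mul_le_mul_of_nonneg_left (hab i z hz) (abs_nonneg _)
  have hAc : ∀ i, ContinuousOn (A i) U := fun i ↦ (contDiffOn_metricMatrix x i i).continuousOn.sqrt
  have hCc : ∀ k, ContinuousOn (C k) U := fun k ↦ continuousOn_finsetSum _ fun i _ ↦
    (contDiffOn_matrix_inv (contDiffOn_metricMatrix x)
      (fun z hz ↦ (metricMatrix_posDef x hz).det_pos.ne') k i).continuousOn.abs.mul (hAc i)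
  have hA0 : ∀ i z, 0 ≤ A i z := fun i z ↦ Real.sqrt_nonneg _
  have hC0 : ∀ i z, 0 ≤ C i z := fun i z ↦
    Finset.sum_nonneg fun _ _ ↦ mul_nonneg (abs_nonneg _) (hA0 _ _)
  -- The product rule applied to `s = ∑ aᵢ Xⁱ`: each term keeps one undifferentiated factor, bounded
  -- by `A i * √s` or `C i * √s`.
  set D : EuclideanSpace ℝ (Fin n) → ℝ := fun z ↦ ∑ i, (A i z * ‖fderiv ℝ
    (coordComp n x (grad n u) i) z‖ + C i z * ‖fderiv ℝ (coordDeriv x u i) z‖) with hD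
  have hDc : ContinuousOn D U := continuousOn_finsetSum _ fun i _ ↦
    ((hAc i).mul ((hX i).continuousOn_fderiv_of_isOpen hUo le_rfl).norm).add
    ((hCc i).mul ((ha i).continuousOn_fderiv_of_isOpen hUo le_rfl).norm)
  have hD0 : ∀ z, 0 ≤ D z := fun z ↦ Finset.sum_nonneg fun i _ ↦
    add_nonneg (mul_nonneg (hA0 i z) (norm_nonneg _)) (mul_nonneg (hC0 i z) (norm_nonneg _))
  have hs1 : ContDiffOn ℝ 1 s U := ContDiffOn.sum fun i _ ↦ (ha i).mul (hX i)
  have hds : ∀ z ∈ U, ‖fderiv ℝ s z‖ ≤ D z * √(s z) := fun z hz ↦ by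
    have dX := fun i ↦ ((hX i).contDiffAt (hUo.mem_nhds hz)).differentiableAt one_ne_zero
    have da := fun i ↦ ((ha i).contDiffAt (hUo.mem_nhds hz)).differentiableAt one_ne_zero
    rw [hs, fderiv_fun_sum fun i _ ↦ (da i).fun_mul (dX i), hD, Finset.sum_mul]
    refine (norm_sum_le _ _).trans (Finset.sum_le_sum fun i _ ↦ ?_)
    rw [fderiv_fun_mul (da i) (dX i)]
    refine (norm_add_le _ _).trans ?_
    rw [norm_smul, norm_smul, add_mul, Real.norm_eq_abs, Real.norm_eq_abs]
    have e1 := mul_le_mul_of_nonneg_right (hab i z hz)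
      (norm_nonneg (fderiv ℝ (coordComp n x (grad n u) i) z))
    have e2 := mul_le_mul_of_nonneg_right (hXb i z hz)
      (norm_nonneg (fderiv ℝ (coordDeriv x u i) z))
    linarith
  have key := contDiffOn_rpow_mul hUo hs1 (hX j) (B := fun z ↦ C j z + D z) ((hCc j).add hDc)
    (fun z hz ↦ by rw [hsn z hz]; positivity)
    (fun z hz ↦ (hXb j z hz).trans (mul_le_mul_of_nonneg_right
      (by linarith [hD0 z]) (Real.sqrt_nonneg _)))
    (fun z hz ↦ (hds z hz).trans (mul_le_mul_of_nonneg_right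
      (by linarith [hC0 j z]) (Real.sqrt_nonneg _)))
    (a := (p - 2) / 2) (by linarith)
  refine key.congr fun z hz ↦ ?_
  rw [coordComp_smul, hsn z hz, ← Real.rpow_natCast, ← Real.rpow_mul (norm_nonneg _)]
  congr 2
  push_cast
  ring

end Gradient

/-! ### Transformation of the volume density under a change of chart. -/

section ChartChange

variable {n : ℕ} {M : Type*} [TopologicalSpace M]
  [ChartedSpace (EuclideanSpace ℝ (Fin n)) M]

/-- The `i`-th coordinate vector at `q` of the preferred chart at `x`, as a vector tangent at `q`
itself. -/
def coordVec (x q : M) (i : Fin n) : TangentSpace (𝓡 n) q :=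
  (coordField n x i (chartAt (EuclideanSpace ℝ (Fin n)) x q) : EuclideanSpace ℝ (Fin n))

/-- The derivative at `q` of the change of coordinates from the preferred chart at `x` to the
preferred chart at `y`. -/
def coordChangeDeriv (x y q : M) : EuclideanSpace ℝ (Fin n) →L[ℝ] EuclideanSpace ℝ (Fin n) :=
  (mfderiv (𝓡 n) (𝓡 n) (chartAt (EuclideanSpace ℝ (Fin n)) y) q :
    EuclideanSpace ℝ (Fin n) →L[ℝ] EuclideanSpace ℝ (Fin n)).comp
  (mfderiv (𝓡 n) (𝓡 n) (chartAt (EuclideanSpace ℝ (Fin n)) x).symm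
    (chartAt (EuclideanSpace ℝ (Fin n)) x q) :
    EuclideanSpace ℝ (Fin n) →L[ℝ] EuclideanSpace ℝ (Fin n))

/-- Moves the inner product from the fibre at `φ.symm (φ q)` to the fibre at `q`, so that matrices
from two charts can be compared in one tangent space. -/
theorem metricMatrix_chart_apply [RiemannianBundle (fun x : M ↦ TangentSpace (𝓡 n) x)]
    (x : M) {q : M} (hq : q ∈ (chartAt (EuclideanSpace ℝ (Fin n)) x).source) (i j : Fin n) :
    metricMatrix n x (chartAt (EuclideanSpace ℝ (Fin n)) x q) i j =
      inner ℝ (coordVec x q i) (coordVec x q j) := by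
  have h : ∀ (q' : M) (v w : TangentSpace (𝓡 n) q), q' = q →
      @inner ℝ (TangentSpace (𝓡 n) q') _ v w = inner ℝ v w := by
    rintro q' v w rfl
    rfl
  exact h _ (coordField n x i (chartAt (EuclideanSpace ℝ (Fin n)) x q))
    (coordField n x j (chartAt (EuclideanSpace ℝ (Fin n)) x q))
    ((chartAt (EuclideanSpace ℝ (Fin n)) x).left_inv hq)

variable [IsManifold (𝓡 n) ∞ M]

theorem hasFDerivAt_coordChange (x y : M) {q : M}
    (hx : q ∈ (chartAt (EuclideanSpace ℝ (Fin n)) x).source)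
    (hy : q ∈ (chartAt (EuclideanSpace ℝ (Fin n)) y).source) :
    HasFDerivAt (chartAt (EuclideanSpace ℝ (Fin n)) y ∘
      (chartAt (EuclideanSpace ℝ (Fin n)) x).symm) (coordChangeDeriv x y q)
      (chartAt (EuclideanSpace ℝ (Fin n)) x q) := by
  have h1 := ((mdifferentiable_chartAt y).mdifferentiableAt hy).hasMFDerivAt
  have h2 := ((mdifferentiable_chartAt x).mdifferentiableAt_symm
    ((chartAt (EuclideanSpace ℝ (Fin n)) x).map_source hx)).hasMFDerivAt
  have h3 : ∀ q', q' = q → HasMFDerivAt (𝓡 n) (𝓡 n)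
      (chartAt (EuclideanSpace ℝ (Fin n)) y) q'
      (mfderiv (𝓡 n) (𝓡 n) (chartAt (EuclideanSpace ℝ (Fin n)) y) q :
        EuclideanSpace ℝ (Fin n) →L[ℝ] EuclideanSpace ℝ (Fin n)) := by
    rintro q' rfl
    exact h1
  exact (HasMFDerivAt.comp (I' := 𝓡 n) _
    (h3 _ ((chartAt (EuclideanSpace ℝ (Fin n)) x).left_inv hx)) h2).hasFDerivAt

theorem coordVec_eq_sum (x y : M) {q : M}
    (hy : q ∈ (chartAt (EuclideanSpace ℝ (Fin n)) y).source) (i : Fin n) :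
    coordVec x q i =
      ∑ k, (coordChangeDeriv x y q (EuclideanSpace.single i (1 : ℝ))) k • coordVec y q k := by
  have h1 := mfderiv_symm_eq_sum y (chartAt (EuclideanSpace ℝ (Fin n)) y q)
    (coordChangeDeriv x y q (EuclideanSpace.single i (1 : ℝ)))
  have h2 := (mdifferentiable_chartAt y).symm_comp_deriv hy
  exact (DFunLike.congr_fun h2 (coordVec x q i)).symm.trans h1

variable [RiemannianBundle (fun x : M ↦ TangentSpace (𝓡 n) x)]

/-- The Gram matrices satisfy `g_x = Jᵀ g_y J`, with `J` the Jacobian matrix; take determinants and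
square roots. -/
theorem volDensity_coordChange (x y : M) {q : M}
    (hx : q ∈ (chartAt (EuclideanSpace ℝ (Fin n)) x).source)
    (hy : q ∈ (chartAt (EuclideanSpace ℝ (Fin n)) y).source) :
    volDensity n x (chartAt (EuclideanSpace ℝ (Fin n)) x q) =
      |(coordChangeDeriv (n := n) x y q).det| *
        volDensity n y (chartAt (EuclideanSpace ℝ (Fin n)) y q) := by
  set b := (EuclideanSpace.basisFun (Fin n) ℝ).toBasis
  set J := LinearMap.toMatrix b b (coordChangeDeriv x y q).toLinearMap with hJ
  have hJe : ∀ k i, J k i = (coordChangeDeriv x y q (EuclideanSpace.single i (1 : ℝ))) k := by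
    intro k i
    simp [hJ, b, LinearMap.toMatrix_apply]
  have hg : metricMatrix n x (chartAt (EuclideanSpace ℝ (Fin n)) x q) =
      J.transpose * metricMatrix n y (chartAt (EuclideanSpace ℝ (Fin n)) y q) * J := by
    ext i j
    rw [metricMatrix_chart_apply x hx, coordVec_eq_sum x y hy i, coordVec_eq_sum x y hy j,
      inner_sum, Matrix.mul_apply]
    refine Finset.sum_congr rfl fun l _ ↦ ?_
    rw [sum_inner, Matrix.mul_apply, Finset.sum_mul]
    refine Finset.sum_congr rfl fun k _ ↦ ?_
    rw [real_inner_smul_left, real_inner_smul_right, metricMatrix_chart_apply y hy,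
      Matrix.transpose_apply, hJe, hJe]
    ring
  have hdet : J.det = (coordChangeDeriv x y q).det := LinearMap.det_toMatrix b _
  rw [volDensity, hg, Matrix.det_mul, Matrix.det_mul, Matrix.det_transpose, hdet, volDensity,
    ← Real.sqrt_sq_eq_abs, ← Real.sqrt_mul (sq_nonneg _)]
  congr 1
  ring

end ChartChange

/-! ### The Riemannian volume and its chart representation. -/

section ChartVolume

variable {n : ℕ} {M : Type*} [TopologicalSpace M]
  [ChartedSpace (EuclideanSpace ℝ (Fin n)) M]
  [MeasurableSpace M] [BorelSpace M]

theorem measurableSet_chart_symm_preimage (x : M) {A : Set M} (hA : MeasurableSet A) :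
    MeasurableSet ((chartAt (EuclideanSpace ℝ (Fin n)) x).symm ⁻¹' A ∩
      (chartAt (EuclideanSpace ℝ (Fin n)) x).target) := by
  have h := (continuousOn_iff_continuous_domRestrict.1
    (chartAt (EuclideanSpace ℝ (Fin n)) x).continuousOn_symm).measurable hA
  convert! (chartAt (EuclideanSpace ℝ (Fin n)) x).open_target.measurableSet.subtype_image h
    using 1
  ext z
  simp [and_comm]

variable [RiemannianBundle (fun x : M ↦ TangentSpace (𝓡 n) x)]

theorem aemeasurable_chart_symm (x : M) :
    AEMeasurable (chartAt (EuclideanSpace ℝ (Fin n)) x).symm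
      ((volume.restrict (chartAt (EuclideanSpace ℝ (Fin n)) x).target).withDensity
        fun z ↦ ENNReal.ofReal (volDensity n x z)) :=
  ((chartAt (EuclideanSpace ℝ (Fin n)) x).continuousOn_symm.aemeasurable
    (chartAt (EuclideanSpace ℝ (Fin n)) x).open_target.measurableSet).mono_ac
    (withDensity_absolutelyContinuous _ _)

theorem chartVolume_apply (x : M) {A : Set M} (hA : MeasurableSet A) :
    chartVolume n x A = ∫⁻ z in (chartAt (EuclideanSpace ℝ (Fin n)) x).symm ⁻¹' A ∩
      (chartAt (EuclideanSpace ℝ (Fin n)) x).target, ENNReal.ofReal (volDensity n x z) := by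
  rw [chartVolume, Measure.map_apply_of_aemeasurable (aemeasurable_chart_symm x) hA,
    withDensity_apply', Measure.restrict_restrict'
      (chartAt (EuclideanSpace ℝ (Fin n)) x).open_target.measurableSet]

theorem chartVolume_restrict_source (x : M) :
    (chartVolume n x).restrict (chartAt (EuclideanSpace ℝ (Fin n)) x).source =
      chartVolume n x := by
  ext A hA
  have ho := (chartAt (EuclideanSpace ℝ (Fin n)) x).open_source.measurableSet
  rw [Measure.restrict_apply hA, chartVolume_apply x hA, chartVolume_apply x (hA.inter ho)]
  congr 2
  ext z
  simp only [Set.mem_inter_iff, Set.mem_preimage]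
  exact ⟨fun h ↦ ⟨h.1.1, h.2⟩, fun h ↦
    ⟨⟨h.1, (chartAt (EuclideanSpace ℝ (Fin n)) x).map_target h.2⟩, h.2⟩⟩

variable [IsManifold (𝓡 n) ∞ M]

/-- Change of variables: the Jacobian determinant it produces is exactly the ratio of the two
densities. -/
theorem chartVolume_apply_eq_of_subset (x y : M) {A : Set M} (hA : MeasurableSet A)
    (hAx : A ⊆ (chartAt (EuclideanSpace ℝ (Fin n)) x).source)
    (hAy : A ⊆ (chartAt (EuclideanSpace ℝ (Fin n)) y).source) :
    chartVolume n x A = chartVolume n y A := by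
  rw [chartVolume_apply x hA, chartVolume_apply y hA]
  set φ := chartAt (EuclideanSpace ℝ (Fin n)) x with hφ
  set θ := chartAt (EuclideanSpace ℝ (Fin n)) y with hθ
  have himg : θ.symm ⁻¹' A ∩ θ.target = (θ ∘ φ.symm) '' (φ.symm ⁻¹' A ∩ φ.target) := by
    ext z
    constructor
    · rintro ⟨h1, h2⟩
      refine ⟨φ (θ.symm z), ⟨?_, φ.map_source (hAx h1)⟩, ?_⟩
      · rw [Set.mem_preimage, φ.left_inv (hAx h1)]
        exact h1
      · rw [Function.comp_apply, φ.left_inv (hAx h1), θ.right_inv h2]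
    · rintro ⟨w, ⟨h1, h2⟩, rfl⟩
      refine ⟨?_, θ.map_source (hAy h1)⟩
      rw [Set.mem_preimage, Function.comp_apply, θ.left_inv (hAy h1)]
      exact h1
  have hder : ∀ z ∈ φ.symm ⁻¹' A ∩ φ.target, HasFDerivWithinAt (θ ∘ φ.symm)
      (coordChangeDeriv x y (φ.symm z)) (φ.symm ⁻¹' A ∩ φ.target) z := by
    rintro z ⟨h1, h2⟩
    have := hasFDerivAt_coordChange x y (hAx h1) (hAy h1)
    rw [φ.right_inv h2] at this
    exact this.hasFDerivWithinAt
  have hinj : Set.InjOn (θ ∘ φ.symm) (φ.symm ⁻¹' A ∩ φ.target) := by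
    rintro z ⟨h1, h2⟩ w ⟨h3, h4⟩ h
    exact φ.symm.injOn h2 h4 (θ.injOn (hAy h1) (hAy h3) h)
  rw [himg, lintegral_image_eq_lintegral_abs_det_fderiv_mul volume
    (measurableSet_chart_symm_preimage x hA) hder hinj]
  refine setLIntegral_congr_fun (measurableSet_chart_symm_preimage x hA) ?_
  rintro z ⟨h1, h2⟩
  have := volDensity_coordChange x y (hAx h1) (hAy h1)
  rw [φ.right_inv h2] at this
  simp only [this, Function.comp_apply]
  rw [ENNReal.ofReal_mul (abs_nonneg _)]

theorem integral_chartVolume [IsContMDiffRiemannianBundle (𝓡 n) ∞ (EuclideanSpace ℝ (Fin n))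
    (fun x : M ↦ TangentSpace (𝓡 n) x)] (x : M) {f : M → ℝ}
    (hf : ContinuousOn f (chartAt (EuclideanSpace ℝ (Fin n)) x).source) :
    ∫ y, f y ∂chartVolume n x =
      ∫ z in (chartAt (EuclideanSpace ℝ (Fin n)) x).target,
        volDensity n x z * f ((chartAt (EuclideanSpace ℝ (Fin n)) x).symm z) := by
  have ho := (chartAt (EuclideanSpace ℝ (Fin n)) x).open_target.measurableSet
  have h1 : AEStronglyMeasurable f (chartVolume n x) := by
    rw [← chartVolume_restrict_source x]
    exact hf.aestronglyMeasurable (chartAt (EuclideanSpace ℝ (Fin n)) x).open_source.measurableSet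
  have h2 : AEMeasurable (fun z ↦ ENNReal.ofReal (volDensity n x z))
      (volume.restrict (chartAt (EuclideanSpace ℝ (Fin n)) x).target) :=
    ((contDiffOn_volDensity x).continuousOn.aemeasurable ho).ennreal_ofReal
  rw [chartVolume, integral_map (aemeasurable_chart_symm x) h1,
    integral_withDensity_eq_integral_toReal_smul₀ h2 (by simp)]
  refine setIntegral_congr_fun ho fun z hz ↦ ?_
  simp only [smul_eq_mul]
  rw [ENNReal.toReal_ofReal (volDensity_pos x hz).le]

variable [SecondCountableTopology M]

/-- The supremum is computed by comparison with a glued measure `μ`: disjointify a countable chart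
cover and sum the chart volumes of the pieces. Agreement on overlaps shows that `μ` restricts to
every chart volume. -/
theorem riemVolume_restrict_source (x : M) :
    (riemVolume n M).restrict (chartAt (EuclideanSpace ℝ (Fin n)) x).source =
      chartVolume n x := by
  have hne : Nonempty M := ⟨x⟩
  obtain ⟨t, htc, ht⟩ := countable_cover_nhds (X := M)
    (U := fun y ↦ (chartAt (EuclideanSpace ℝ (Fin n)) y).source)
    fun y ↦ (chartAt (EuclideanSpace ℝ (Fin n)) y).open_source.mem_nhds (mem_chart_source _ y)
  have htne : t.Nonempty := by
    by_contra h
    rw [Set.not_nonempty_iff_eq_empty.1 h] at ht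
    have := Set.mem_univ x
    rw [← ht] at this
    simp at this
  obtain ⟨e, rfl⟩ := htc.exists_eq_range htne
  set S : ℕ → Set M := disjointed fun k ↦ (chartAt (EuclideanSpace ℝ (Fin n)) (e k)).source with hS
  have hSm : ∀ k, MeasurableSet (S k) := MeasurableSet.disjointed fun k ↦
    (chartAt (EuclideanSpace ℝ (Fin n)) (e k)).open_source.measurableSet
  have hSd : Pairwise (Function.onFun Disjoint S) := disjoint_disjointed _
  have hSU : ⋃ k, S k = Set.univ := by
    rw [hS, iUnion_disjointed, ← ht, Set.biUnion_range]
  have hSs : ∀ k, S k ⊆ (chartAt (EuclideanSpace ℝ (Fin n)) (e k)).source := disjointed_le _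
  set μ : Measure M := Measure.sum fun k ↦ (chartVolume n (e k)).restrict (S k) with hμ
  have hμy : ∀ y : M, μ.restrict (chartAt (EuclideanSpace ℝ (Fin n)) y).source =
      chartVolume n y := by
    intro y
    have ho := (chartAt (EuclideanSpace ℝ (Fin n)) y).open_source.measurableSet
    rw [← chartVolume_restrict_source y]
    ext A hA
    rw [Measure.restrict_apply hA, Measure.restrict_apply hA, hμ,
      Measure.sum_apply _ (hA.inter ho)]
    have h1 : A ∩ (chartAt (EuclideanSpace ℝ (Fin n)) y).source =
        ⋃ k, (A ∩ (chartAt (EuclideanSpace ℝ (Fin n)) y).source) ∩ S k := by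
      rw [← Set.inter_iUnion, hSU, Set.inter_univ]
    conv_rhs => rw [h1]
    rw [measure_iUnion (fun i j hij ↦ (hSd hij).mono Set.inter_subset_right
      Set.inter_subset_right) fun k ↦ (hA.inter ho).inter (hSm k)]
    refine tsum_congr fun k ↦ ?_
    rw [Measure.restrict_apply (hA.inter ho)]
    exact chartVolume_apply_eq_of_subset _ _ ((hA.inter ho).inter (hSm k))
      (Set.inter_subset_right.trans (hSs k))
      (Set.inter_subset_left.trans Set.inter_subset_right)
  -- The supremum is at most `μ`, which dominates every chart volume, and at least the chart volume
  -- at `x`. On the source of the chart at `x` these two bounds coincide.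
  have hle : riemVolume n M ≤ μ := iSup_le fun y ↦ by
    rw [← hμy y]
    exact Measure.restrict_le_self
  refine le_antisymm ?_ ?_
  · rw [← hμy x]
    exact Measure.restrict_mono_measure hle _
  · rw [← chartVolume_restrict_source x]
    exact Measure.restrict_mono_measure (le_iSup (fun y ↦ chartVolume n y) x) _

variable [IsContMDiffRiemannianBundle (𝓡 n) ∞ (EuclideanSpace ℝ (Fin n))
      (fun x : M ↦ TangentSpace (𝓡 n) x)]

instance isLocallyFiniteMeasure_riemVolume : IsLocallyFiniteMeasure (riemVolume n M) := by
  refine ⟨fun x ↦ ?_⟩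
  set φ := chartAt (EuclideanSpace ℝ (Fin n)) x with hφ
  obtain ⟨K, hK, hxK, hKt⟩ := exists_compact_subset φ.open_target
    (φ.map_source (mem_chart_source _ x))
  have hV : IsOpen (φ.source ∩ φ ⁻¹' interior K) :=
    φ.isOpen_inter_preimage isOpen_interior
  refine ⟨_, hV.mem_nhds ⟨mem_chart_source _ x, hxK⟩, ?_⟩
  have h1 : riemVolume n M (φ.source ∩ φ ⁻¹' interior K) =
      chartVolume n x (φ.source ∩ φ ⁻¹' interior K) := by
    rw [← riemVolume_restrict_source x, Measure.restrict_apply hV.measurableSet,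
      Set.inter_eq_left.2 Set.inter_subset_left]
  rw [h1, chartVolume_apply x hV.measurableSet]
  refine lt_of_le_of_lt (lintegral_mono_set (t := K) ?_) ((((contDiffOn_volDensity
    x).continuousOn.mono hKt).integrableOn_compact hK).lintegral_lt_top)
  rintro z ⟨h2, h3⟩
  have := h2.2
  rw [Set.mem_preimage, φ.right_inv h3] at this
  exact interior_subset this

end ChartVolume

/-! ### Chart independence of the divergence and the divergence theorem. -/

section IntegrationByParts

variable {n : ℕ} {M : Type*} [TopologicalSpace M]
  [ChartedSpace (EuclideanSpace ℝ (Fin n)) M]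

/-- The components of the vector field `X` in all the preferred charts are `C^1`. -/
def HasC1Components (X : ∀ y : M, TangentSpace (𝓡 n) y) : Prop :=
  ∀ x i, ContDiffOn ℝ 1 (coordComp n x X i) (chartAt (EuclideanSpace ℝ (Fin n)) x).target

/-- The coordinate formula for the divergence, at an arbitrary point of the preferred chart
at `x`. -/
def chartDivergence [RiemannianBundle (fun x : M ↦ TangentSpace (𝓡 n) x)] (x : M)
    (X : ∀ y : M, TangentSpace (𝓡 n) y) (z : EuclideanSpace ℝ (Fin n)) : ℝ :=
  (volDensity n x z)⁻¹ * ∑ i, fderiv ℝ (fun z ↦ volDensity n x z * coordComp n x X i z) z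
    (EuclideanSpace.single i (1 : ℝ))

variable [RiemannianBundle (fun x : M ↦ TangentSpace (𝓡 n) x)]

theorem grad_eq_zero_of_eventuallyEq {w : M → ℝ} {y : M} (h : w =ᶠ[𝓝 y] fun _ ↦ 0) :
    grad n w y = 0 := by
  have h1 := ((hasMFDerivAt_const (I := 𝓡 n) (I' := 𝓘(ℝ, ℝ)) (0 : ℝ) y).congr_of_eventuallyEq
    h).mfderiv
  have h2 : mvfderiv (𝓡 n) w y = 0 := by
    unfold mvfderiv
    rw [h1]
    ext v
    rfl
  simp [grad, h2]

theorem grad_eq_zero_of_notMem_tsupport {w : M → ℝ} {y : M} (h : y ∉ tsupport w) :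
    grad n w y = 0 :=
  grad_eq_zero_of_eventuallyEq (notMem_tsupport_iff_eventuallyEq.1 h)

theorem grad_add {w w' : M → ℝ} {y : M} (hw : MDifferentiableAt (𝓡 n) 𝓘(ℝ, ℝ) w y)
    (hw' : MDifferentiableAt (𝓡 n) 𝓘(ℝ, ℝ) w' y) :
    grad n (w + w') y = grad n w y + grad n w' y := by
  have h := mvfderiv_add hw hw'
  simp only [grad, h, map_add]

variable [IsManifold (𝓡 n) ∞ M]

theorem continuousOn_inner_grad_source {w : M → ℝ} (hw : ContMDiff (𝓡 n) 𝓘(ℝ, ℝ) 1 w)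
    {X : ∀ y : M, TangentSpace (𝓡 n) y}
    (hX : ∀ x i, ContinuousOn (coordComp n x X i) (chartAt (EuclideanSpace ℝ (Fin n)) x).target)
    (x : M) :
    ContinuousOn (fun y ↦ inner ℝ (grad n w y) (X y))
      (chartAt (EuclideanSpace ℝ (Fin n)) x).source := by
  set φ := chartAt (EuclideanSpace ℝ (Fin n)) x
  have h1 : ContinuousOn (fun z ↦ ∑ j, coordDeriv x w j z * coordComp n x X j z) φ.target :=
    continuousOn_finsetSum _ fun j _ ↦
      (contDiffOn_coordDeriv (m := 1) (m' := 0) x hw (by simp) j).continuousOn.mul (hX x j)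
  refine (h1.comp φ.continuousOn φ.mapsTo).congr fun y hy ↦ ?_
  have := inner_grad_eq_sum x (φ.map_source hy) (hw.mdifferentiable one_ne_zero _) X
  rwa [φ.left_inv hy] at this

theorem continuous_inner_grad {w : M → ℝ} (hw : ContMDiff (𝓡 n) 𝓘(ℝ, ℝ) 1 w)
    {X : ∀ y : M, TangentSpace (𝓡 n) y}
    (hX : ∀ x i, ContinuousOn (coordComp n x X i) (chartAt (EuclideanSpace ℝ (Fin n)) x).target) :
    Continuous (fun y ↦ inner ℝ (grad n w y) (X y)) :=
  continuous_iff_continuousAt.2 fun y ↦ (continuousOn_inner_grad_source hw hX y).continuousAt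
    ((chartAt (EuclideanSpace ℝ (Fin n)) y).open_source.mem_nhds (mem_chart_source _ y))

variable [IsContMDiffRiemannianBundle (𝓡 n) ∞ (EuclideanSpace ℝ (Fin n))
      (fun x : M ↦ TangentSpace (𝓡 n) x)]

theorem contDiffOn_volDensity_mul {X : ∀ y : M, TangentSpace (𝓡 n) y} (hX : HasC1Components X)
    (x : M) (i : Fin n) :
    ContDiffOn ℝ 1 (fun z ↦ volDensity n x z * coordComp n x X i z)
      (chartAt (EuclideanSpace ℝ (Fin n)) x).target :=
  ((contDiffOn_volDensity x).of_le (by simp)).mul (hX x i)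

theorem continuousOn_chartDivergence {X : ∀ y : M, TangentSpace (𝓡 n) y}
    (hX : HasC1Components X) (x : M) :
    ContinuousOn (fun y ↦ chartDivergence x X (chartAt (EuclideanSpace ℝ (Fin n)) x y))
      (chartAt (EuclideanSpace ℝ (Fin n)) x).source := by
  set φ := chartAt (EuclideanSpace ℝ (Fin n)) x
  have h1 : ContinuousOn (chartDivergence x X) φ.target :=
    ((contDiffOn_volDensity x).continuousOn.inv₀ fun z hz ↦ (volDensity_pos x hz).ne').mul
      (continuousOn_finsetSum _ fun i _ ↦ ((contDiffOn_volDensity_mul hX x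
        i).continuousOn_fderiv_of_isOpen φ.open_target le_rfl).clm_apply continuousOn_const)
  exact h1.comp φ.continuousOn φ.mapsTo

variable [MeasurableSpace M] [BorelSpace M] [SecondCountableTopology M]

/-- In the chart the density cancels the prefactor `(det g)^(-1/2)`, leaving a Euclidean integration
by parts in each coordinate. -/
theorem integral_mul_chartDivergence [T2Space M] {X : ∀ y : M, TangentSpace (𝓡 n) y}
    (hX : HasC1Components X) (x : M) {w : M → ℝ} (hw : ContMDiff (𝓡 n) 𝓘(ℝ, ℝ) 1 w)
    {K : Set M} (hK : IsCompact K) (hKx : K ⊆ (chartAt (EuclideanSpace ℝ (Fin n)) x).source)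
    (hw0 : ∀ y ∉ K, w y = 0) :
    ∫ y, w y * chartDivergence x X (chartAt (EuclideanSpace ℝ (Fin n)) x y) ∂riemVolume n M =
      -∫ y, inner ℝ (grad n w y) (X y) ∂riemVolume n M := by
  set φ := chartAt (EuclideanSpace ℝ (Fin n)) x with hφ
  have hg0 : ∀ y ∉ K, grad n w y = 0 := fun y hy ↦ grad_eq_zero_of_eventuallyEq <| by
    filter_upwards [hK.isClosed.isOpen_compl.mem_nhds hy] with q hq using hw0 q hq
  have hd := fun y : M ↦ hw.mdifferentiable one_ne_zero y
  have hsub : ∀ f : M → ℝ, (∀ y ∉ K, f y = 0) → ContinuousOn f φ.source →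
      ∫ y, f y ∂riemVolume n M = ∫ z in φ.target, volDensity n x z * f (φ.symm z) := by
    intro f hf hfc
    rw [← integral_chartVolume x hfc, ← riemVolume_restrict_source x,
      setIntegral_eq_integral_of_forall_compl_eq_zero fun y hy ↦ hf y fun h ↦ hy (hKx h)]
  rw [hsub _ (fun y hy ↦ by rw [hw0 y hy, zero_mul])
      (hw.continuous.continuousOn.fun_mul (continuousOn_chartDivergence hX x)),
    hsub _ (fun y hy ↦ by rw [hg0 y hy, inner_zero_left])
      (continuousOn_inner_grad_source hw (fun x i ↦ (hX x i).continuousOn) x)]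
  have hwc := contDiffOn_comp_chart_symm (m := 1) x hw
  have hK' : IsCompact (φ '' K) := hK.image_of_continuousOn (φ.continuousOn.mono hKx)
  have hKt : φ '' K ⊆ φ.target := by
    rintro _ ⟨y, hy, rfl⟩
    exact φ.map_source (hKx hy)
  have hz : ∀ z ∈ φ.target \ φ '' K, φ.symm z ∉ K := fun z hz h ↦
    hz.2 ⟨_, h, φ.right_inv hz.1⟩
  have e1 : ∀ z ∈ φ.target, volDensity n x z * (w (φ.symm z) *
      chartDivergence x X (φ (φ.symm z))) = ∑ i, (w ∘ φ.symm) z *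
        fderiv ℝ (fun z ↦ volDensity n x z * coordComp n x X i z) z
          (EuclideanSpace.single i (1 : ℝ)) := by
    intro z hz
    have := (volDensity_pos x hz).ne'
    rw [φ.right_inv hz, chartDivergence, ← Finset.mul_sum, Function.comp_apply]
    field_simp
  have e2 : ∀ z ∈ φ.target, volDensity n x z * inner ℝ (grad n w (φ.symm z)) (X (φ.symm z)) =
      ∑ i, fderiv ℝ (w ∘ φ.symm) z (EuclideanSpace.single i (1 : ℝ)) *
        (volDensity n x z * coordComp n x X i z) := by
    intro z hz
    rw [inner_grad_eq_sum x hz (hd _), Finset.mul_sum]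
    refine Finset.sum_congr rfl fun i _ ↦ ?_
    rw [coordDeriv]
    ring
  have hot := φ.open_target.measurableSet
  have hvc : ∀ i, ContDiffOn ℝ 1 (fun z ↦ volDensity n x z * coordComp n x X i z) φ.target :=
    contDiffOn_volDensity_mul hX x
  have hw0' : ∀ z ∈ φ.target \ φ '' K, (w ∘ φ.symm) z = 0 := fun z h ↦ hw0 _ (hz z h)
  have hdw0 : ∀ z ∈ φ.target \ φ '' K, fderiv ℝ (w ∘ φ.symm) z = 0 := by
    intro z hz
    have : (w ∘ φ.symm) =ᶠ[𝓝 z] fun _ ↦ 0 := by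
      filter_upwards [(φ.open_target.sdiff hK'.isClosed).mem_nhds hz] with y hy using hw0' y hy
    rw [this.fderiv_eq]
    simp
  rw [setIntegral_congr_fun hot e1, setIntegral_congr_fun hot e2, integral_finsetSum,
    integral_finsetSum, ← Finset.sum_neg_distrib]
  · exact Finset.sum_congr rfl fun i _ ↦
      integral_mul_fderiv_eq_neg_of_eq_zero_off_compact φ.open_target hwc (hvc i) hK' hKt hw0' _
  · exact fun i _ ↦ integrableOn_of_eq_zero_off_compact hot
      (((hwc.continuousOn_fderiv_of_isOpen φ.open_target le_rfl).clm_apply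
        continuousOn_const).mul (hvc i).continuousOn) hK' hKt fun z h ↦ by simp [hdw0 z h]
  · exact fun i _ ↦ integrableOn_of_eq_zero_off_compact hot (hwc.continuousOn.mul
      (((hvc i).continuousOn_fderiv_of_isOpen φ.open_target le_rfl).clm_apply
        continuousOn_const)) hK' hKt fun z h ↦ by rw [hw0' z h, zero_mul]

instance isOpenPosMeasure_riemVolume : (riemVolume n M).IsOpenPosMeasure := by
  refine ⟨fun U hU ⟨q, hq⟩ h0 ↦ ?_⟩
  set φ := chartAt (EuclideanSpace ℝ (Fin n)) q
  have h1 : chartVolume n q U = 0 := by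
    rw [← riemVolume_restrict_source q]
    exact Measure.restrict_le_self.absolutelyContinuous h0
  rw [chartVolume_apply q hU.measurableSet] at h1
  have ho : IsOpen (φ.symm ⁻¹' U ∩ φ.target) := by
    rw [Set.inter_comm]
    exact φ.isOpen_inter_preimage_symm hU
  rw [setLIntegral_eq_zero_iff' ho.measurableSet
    (((contDiffOn_volDensity q).continuousOn.mono Set.inter_subset_right).aemeasurable
      ho.measurableSet).ennreal_ofReal] at h1
  have h2 : volume (φ.symm ⁻¹' U ∩ φ.target) = 0 := by
    rw [measure_eq_zero_iff_ae_notMem]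
    filter_upwards [h1] with z hz hzm
    have := hz hzm
    simp only [ENNReal.ofReal_eq_zero] at this
    exact absurd (volDensity_pos q hzm.2) this.not_gt
  refine (ho.measure_pos volume ⟨φ q, ?_, φ.map_source (mem_chart_source _ q)⟩).ne' h2
  rw [Set.mem_preimage, φ.left_inv (mem_chart_source _ q)]
  exact hq

/-- Chart independence without computing a coordinate change: on the overlap both expressions have
the same integral against every test function, because `integral_mul_chartDivergence` turns each
into the invariant `-∫ ⟨∇g, X⟩`. Hence they agree almost everywhere, and everywhere by continuity,
as the volume is positive on nonempty open sets. -/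
theorem chartDivergence_eq_divergence [T2Space M] {X : ∀ y : M, TangentSpace (𝓡 n) y}
    (hX : HasC1Components X) (x : M) {q : M}
    (hq : q ∈ (chartAt (EuclideanSpace ℝ (Fin n)) x).source) :
    chartDivergence x X (chartAt (EuclideanSpace ℝ (Fin n)) x q) = divergence n X q := by
  have : LocallyCompactSpace M := ChartedSpace.locallyCompactSpace (EuclideanSpace ℝ (Fin n)) M
  set φ := chartAt (EuclideanSpace ℝ (Fin n)) x
  set θ := chartAt (EuclideanSpace ℝ (Fin n)) q
  set O := φ.source ∩ θ.source with hO
  have hOo : IsOpen O := φ.open_source.inter θ.open_source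
  have c1 : ContinuousOn (fun y ↦ chartDivergence x X (φ y)) O :=
    (continuousOn_chartDivergence hX x).mono Set.inter_subset_left
  have c2 : ContinuousOn (fun y ↦ chartDivergence q X (θ y)) O :=
    (continuousOn_chartDivergence hX q).mono Set.inter_subset_right
  have key := hOo.ae_eq_zero_of_integral_contMDiff_smul_eq_zero (𝓡 n) (μ := riemVolume n M)
    (f := fun y ↦ chartDivergence x X (φ y) - chartDivergence q X (θ y))
    ((c1.sub c2).locallyIntegrableOn hOo.measurableSet) ?_
  · have h2 : (fun y ↦ chartDivergence x X (φ y)) =ᵐ[(riemVolume n M).restrict O]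
        fun y ↦ chartDivergence q X (θ y) := by
      rw [EventuallyEq, ae_restrict_iff' hOo.measurableSet]
      filter_upwards [key] with y hy hyO
      exact sub_eq_zero.1 (hy hyO)
    exact Measure.eqOn_open_of_ae_eq h2 hOo c1 c2 ⟨hq, mem_chart_source _ q⟩
  · intro g hg hgc hgO
    have hg1 : ContMDiff (𝓡 n) 𝓘(ℝ, ℝ) 1 g := hg.of_le (by simp)
    have hg0 : ∀ y ∉ tsupport g, g y = 0 := fun y hy ↦ image_eq_zero_of_notMem_tsupport hy
    have hi : ∀ d : M → ℝ, ContinuousOn d O → Integrable (fun y ↦ g y * d y) (riemVolume n M) :=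
      fun d hd ↦ by
        rw [← integrableOn_univ]
        refine (integrableOn_of_eq_zero_off_compact hOo.measurableSet
          (hg.continuous.continuousOn.fun_mul hd) hgc hgO fun z hz ↦ by
            rw [hg0 z hz.2, zero_mul]).of_forall_sdiff_eq_zero MeasurableSet.univ fun y hy ↦ by
            rw [hg0 y fun h ↦ hy.2 (hgO h), zero_mul]
    simp only [smul_eq_mul, mul_sub]
    rw [integral_sub (hi _ c1) (hi _ c2), integral_mul_chartDivergence hX x hg1 hgc
      (hgO.trans Set.inter_subset_left) hg0, integral_mul_chartDivergence hX q hg1 hgc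
      (hgO.trans Set.inter_subset_right) hg0, sub_self]

theorem continuous_divergence [T2Space M] {X : ∀ y : M, TangentSpace (𝓡 n) y}
    (hX : HasC1Components X) : Continuous (divergence n X) :=
  continuous_iff_continuousAt.2 fun x ↦
    (((continuousOn_chartDivergence hX x).congr fun _ hy ↦
      (chartDivergence_eq_divergence hX x hy).symm).continuousAt
    ((chartAt (EuclideanSpace ℝ (Fin n)) x).open_source.mem_nhds (mem_chart_source _ x)))

/-- The divergence theorem against a compactly supported `C^1` function. -/
theorem integral_mul_divergence [T2Space M] {X : ∀ y : M, TangentSpace (𝓡 n) y}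
    (hX : HasC1Components X) {w : M → ℝ} (hw : ContMDiff (𝓡 n) 𝓘(ℝ, ℝ) 1 w)
    (hwc : HasCompactSupport w) :
    ∫ y, w y * divergence n X y ∂riemVolume n M =
      -∫ y, inner ℝ (grad n w y) (X y) ∂riemVolume n M := by
  have : LocallyCompactSpace M := ChartedSpace.locallyCompactSpace (EuclideanSpace ℝ (Fin n)) M
  -- Regularity and compact support are part of `P` because additivity of the identity needs the
  -- integrability that they provide.
  let P : (M → ℝ) → Prop := fun w ↦ ContMDiff (𝓡 n) 𝓘(ℝ, ℝ) 1 w ∧ HasCompactSupport w ∧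
    ∫ y, w y * divergence n X y ∂riemVolume n M =
      -∫ y, inner ℝ (grad n w y) (X y) ∂riemVolume n M
  have hPadd : ∀ w w', P w → P w' → P (w + w') := by
    rintro w w' ⟨h1, h2, h3⟩ ⟨h1', h2', h3'⟩
    refine ⟨h1.add h1', h2.add h2', ?_⟩
    have i1 : ∀ v : M → ℝ, ContMDiff (𝓡 n) 𝓘(ℝ, ℝ) 1 v → HasCompactSupport v →
        Integrable (fun y ↦ v y * divergence n X y) (riemVolume n M) := fun v hv hvc ↦
      (hv.continuous.fun_mul (continuous_divergence hX)).integrable_of_hasCompactSupport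
        (hvc.mul_right (f' := divergence n X))
    have i2 : ∀ v : M → ℝ, ContMDiff (𝓡 n) 𝓘(ℝ, ℝ) 1 v → HasCompactSupport v →
        Integrable (fun y ↦ inner ℝ (grad n v y) (X y)) (riemVolume n M) := fun v hv hvc ↦
      (continuous_inner_grad hv fun x i ↦ (hX x i).continuousOn).integrable_of_hasCompactSupport
        (HasCompactSupport.intro hvc fun y hy ↦ by
          rw [grad_eq_zero_of_notMem_tsupport hy, inner_zero_left])
    have e1 : ∀ y, inner ℝ (grad n (w + w') y) (X y) =
        inner ℝ (grad n w y) (X y) + inner ℝ (grad n w' y) (X y) := fun y ↦ by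
      rw [grad_add (h1.mdifferentiable one_ne_zero _) (h1'.mdifferentiable one_ne_zero _),
        inner_add_left]
    simp only [e1, Pi.add_apply, add_mul]
    rw [integral_add (i1 w h1 h2) (i1 w' h1' h2'), integral_add (i2 w h1 h2) (i2 w' h1' h2'),
      h3, h3']
    ring
  have hP0 : P 0 := by
    refine ⟨contMDiff_const, HasCompactSupport.zero, ?_⟩
    have : ∀ y, grad n (0 : M → ℝ) y = 0 := fun y ↦
      grad_eq_zero_of_eventuallyEq (Eventually.of_forall fun _ ↦ rfl)
    simp [this]
  obtain ⟨χ, hχ⟩ := SmoothPartitionOfUnity.exists_isSubordinate_chartAt_source (𝓡 n) M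
  have hfin := (χ.locallyFinite.finite_nonempty_inter_compact hwc)
  -- Local finiteness leaves finitely many members of the partition of unity meeting the support of
  -- `w`.
  have hsum : w = ∑ i ∈ hfin.toFinset, fun y ↦ χ i y * w y := by
    ext y
    rw [Finset.sum_apply, ← Finset.sum_mul]
    by_cases hy : y ∈ tsupport w
    · rw [χ.sum_finsupport' y (Set.mem_univ y), one_mul]
      intro i hi
      rw [Set.Finite.mem_toFinset]
      exact ⟨y, (χ.mem_finsupport y).1 hi, hy⟩
    · rw [image_eq_zero_of_notMem_tsupport hy, mul_zero]
  have hPi : ∀ i, P fun y ↦ χ i y * w y := by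
    intro i
    have hc1 : ContMDiff (𝓡 n) 𝓘(ℝ, ℝ) 1 fun y ↦ χ i y * w y :=
      ((χ i).contMDiff.of_le (by simp)).mul hw
    refine ⟨hc1, hwc.mul_left (f := χ i), ?_⟩
    have hK : IsCompact (tsupport w ∩ tsupport (χ i)) :=
      IsCompact.inter_right hwc (isClosed_tsupport _)
    have hK0 : ∀ y ∉ tsupport w ∩ tsupport (χ i), χ i y * w y = 0 := by
      intro y hy
      by_cases h : y ∈ tsupport w
      · rw [image_eq_zero_of_notMem_tsupport fun h' ↦ hy ⟨h, h'⟩, zero_mul]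
      · rw [image_eq_zero_of_notMem_tsupport h, mul_zero]
    rw [← integral_mul_chartDivergence hX i hc1 hK (Set.inter_subset_right.trans (hχ i)) hK0]
    refine integral_congr_ae (Eventually.of_forall fun y ↦ ?_)
    by_cases hy : y ∈ tsupport w ∩ tsupport (χ i)
    · simp only [chartDivergence_eq_divergence hX i (hχ i hy.2)]
    · simp only [hK0 y hy, zero_mul]
  have hPw : P w := by
    rw [hsum]
    exact Finset.sum_induction _ P hPadd hP0 fun i _ ↦ hPi i
  exact hPw.2.2

end IntegrationByParts

/-! ### The Poincaré inequality and positivity of the first eigenvalue. -/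

section Eigenvalue

/-- A crude Young inequality, by comparing `p * a` with `b`: the left side is at most the `p`-th
power of the larger one. The coefficient `1` of `b ^ p` is what makes the absorption exact. -/
theorem mul_rpow_sub_one_le {p a b : ℝ} (hp : 1 < p) (ha : 0 ≤ a) (hb : 0 ≤ b) :
    p * (a * b ^ (p - 1)) ≤ p ^ p * a ^ p + b ^ p := by
  have hpow : ∀ x : ℝ, 0 ≤ x → x * x ^ (p - 1) = x ^ p := fun x hx ↦ by
    have h := Real.rpow_add_of_nonneg hx zero_le_one (show 0 ≤ p - 1 by linarith)
    rw [Real.rpow_one] at h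
    rw [← h]
    congr 1
    ring
  rcases le_total (p * a) b with h | h
  · calc p * (a * b ^ (p - 1)) = (p * a) * b ^ (p - 1) := by ring
      _ ≤ b * b ^ (p - 1) := by gcongr
      _ = b ^ p := hpow b hb
      _ ≤ _ := le_add_of_nonneg_left (by positivity)
  · calc p * (a * b ^ (p - 1)) = (p * a) * b ^ (p - 1) := by ring
      _ ≤ (p * a) * (p * a) ^ (p - 1) := by
        have : b ^ (p - 1) ≤ (p * a) ^ (p - 1) := Real.rpow_le_rpow hb h (by linarith)
        gcongr
      _ = p ^ p * a ^ p := by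
        rw [hpow _ (by positivity), Real.mul_rpow (by positivity) ha]
      _ ≤ _ := le_add_of_nonneg_right (by positivity)

variable {n : ℕ} {M : Type*} [TopologicalSpace M]
  [ChartedSpace (EuclideanSpace ℝ (Fin n)) M]
  [RiemannianBundle (fun x : M ↦ TangentSpace (𝓡 n) x)]

theorem grad_comp {f : ℝ → ℝ} {f' : ℝ} {w : M → ℝ} {y : M} (hf : HasDerivAt f f' (w y))
    (hw : MDifferentiableAt (𝓡 n) 𝓘(ℝ, ℝ) w y) :
    grad n (fun y ↦ f (w y)) y = f' • grad n w y := by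
  have h : mvfderiv (𝓡 n) (fun y ↦ f (w y)) y = f' • mvfderiv (𝓡 n) w y := by
    ext v
    refine (mvfderiv_comp_apply y hf.differentiableAt.mdifferentiableAt hw v).trans ?_
    have h2 : mvfderiv 𝓘(ℝ, ℝ) f (w y) = fderiv ℝ f (w y) := by
      unfold mvfderiv
      rw [mfderiv_eq_fderiv]
      rfl
    rw [h2, hf.hasFDerivAt.fderiv]
    exact mul_comm (mvfderiv (𝓡 n) w y v) f'
  simp only [grad, h, map_smul]

theorem grad_mul {f g : M → ℝ} {y : M} (hf : MDifferentiableAt (𝓡 n) 𝓘(ℝ, ℝ) f y)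
    (hg : MDifferentiableAt (𝓡 n) 𝓘(ℝ, ℝ) g y) :
    grad n (fun y ↦ f y * g y) y = f y • grad n g y + g y • grad n f y := by
  have h := mvfderiv_mul hf hg
  have h2 : grad n (f * g) y = f y • grad n g y + g y • grad n f y := by
    simp only [grad, h, map_add, map_smul]
  exact h2

/-- The weight `e^u` reproduces itself under differentiation and yields the good term `-e^u |φ|^p
|∇u|^p`. It absorbs the cross term through Young's inequality with `a = |∇φ|` and `b = |φ| |∇u|`. -/
theorem neg_inner_grad_rpow_mul_exp_le {p : ℝ} (hp : 2 ≤ p) {u φ : M → ℝ} {y : M}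
    (hu : MDifferentiableAt (𝓡 n) 𝓘(ℝ, ℝ) u y) (hφ : MDifferentiableAt (𝓡 n) 𝓘(ℝ, ℝ) φ y) :
    -inner ℝ (grad n (fun y ↦ |φ y| ^ p * Real.exp (u y)) y)
      (‖grad n u y‖ ^ (p - 2) • grad n u y) ≤
      p ^ p * (Real.exp (u y) * ‖grad n φ y‖ ^ p) := by
  have d1 := hasDerivAt_abs_rpow (φ y) (show 1 < p by linarith)
  have d2 := Real.hasDerivAt_exp (u y)
  have m1 : MDifferentiableAt (𝓡 n) 𝓘(ℝ, ℝ) (fun y ↦ |φ y| ^ p) y :=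
    d1.differentiableAt.mdifferentiableAt.comp y hφ
  have m2 : MDifferentiableAt (𝓡 n) 𝓘(ℝ, ℝ) (fun y ↦ Real.exp (u y)) y :=
    d2.differentiableAt.mdifferentiableAt.comp y hu
  rw [grad_mul m1 m2, grad_comp d1 hφ, grad_comp d2 hu]
  simp only [inner_add_left, real_inner_smul_left, real_inner_smul_right,
    real_inner_self_eq_norm_sq]
  set a := ‖grad n φ y‖
  set b := ‖grad n u y‖
  have ha : 0 ≤ a := norm_nonneg _
  have hb : 0 ≤ b := norm_nonneg _
  have e1 : b ^ (p - 2) * b ^ 2 = b ^ p := by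
    rw [← Real.rpow_natCast, ← Real.rpow_add_of_nonneg hb (by linarith) (by norm_num)]
    congr 1
    push_cast
    ring
  have e2 : b ^ (p - 2) * b = b ^ (p - 1) := by
    -- Writing each `b` as `b ^ 1` lets the exponents add, including at `b = 0`, because `p - 2` and
    -- `1` are both nonnegative.
    conv_lhs => rw [← Real.rpow_one b, ← Real.rpow_mul hb, one_mul,
      ← Real.rpow_add_of_nonneg hb (by linarith) (by norm_num)]
    congr 1
    ring
  have e3 : |φ y| ^ (p - 2) * |φ y| = |φ y| ^ (p - 1) := by
    conv_lhs => rw [← Real.rpow_one |φ y|, ← Real.rpow_mul (abs_nonneg _), one_mul,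
      ← Real.rpow_add_of_nonneg (abs_nonneg _) (by linarith) (by norm_num)]
    congr 1
    ring
  have e4 : -(φ y * inner ℝ (grad n φ y) (grad n u y)) ≤ |φ y| * (a * b) := by
    refine (neg_le_abs _).trans ?_
    rw [abs_mul]
    gcongr
    exact abs_real_inner_le_norm _ _
  have hy := mul_rpow_sub_one_le (show 1 < p by linarith) ha
    (mul_nonneg (abs_nonneg (φ y)) hb)
  rw [Real.mul_rpow (abs_nonneg _) hb, Real.mul_rpow (abs_nonneg _) hb] at hy
  have hE := Real.exp_pos (u y)
  set E := Real.exp (u y)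
  have e5 : E * (p * |φ y| ^ (p - 2) * b ^ (p - 2)) *
      -(φ y * inner ℝ (grad n φ y) (grad n u y)) ≤
      E * (p * (a * (|φ y| ^ (p - 1) * b ^ (p - 1)))) := by
    refine (mul_le_mul_of_nonneg_left e4 (by positivity)).trans_eq ?_
    rw [← e2, ← e3]
    ring
  have e6 := mul_le_mul_of_nonneg_left hy hE.le
  rw [← e1] at e6
  nlinarith [e5, e6]

variable [IsManifold (𝓡 n) ∞ M] [IsContMDiffRiemannianBundle (𝓡 n) ∞ (EuclideanSpace ℝ (Fin n))
      (fun x : M ↦ TangentSpace (𝓡 n) x)]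

theorem continuous_norm_grad {w : M → ℝ} (hw : ContMDiff (𝓡 n) 𝓘(ℝ, ℝ) 1 w) :
    Continuous fun y ↦ ‖grad n w y‖ := by
  have h := continuous_inner_grad hw (X := grad n w) fun x i ↦
    (contDiffOn_coordComp_grad (m := 1) (m' := 0) x hw (by simp) i).continuousOn
  refine h.sqrt.congr fun y ↦ ?_
  rw [real_inner_self_eq_norm_sq, Real.sqrt_sq (norm_nonneg _)]

/-- The fibre norm is continuous on the total space of the tangent bundle, being the square root of
the smooth function `⟨v, v⟩`. -/
theorem aemeasurable_enorm_of_aestronglyMeasurable [MeasurableSpace M] {μ : Measure M}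
    {G : ∀ x : M, TangentSpace (𝓡 n) x}
    (hG : AEStronglyMeasurable (fun x ↦ (⟨x, G x⟩ : TangentBundle (𝓡 n) M)) μ) :
    AEMeasurable (fun x ↦ ‖G x‖ₑ) μ := by
  have h1 : ContMDiff (𝓡 n).tangent 𝓘(ℝ, ℝ) ∞
      (fun v : TangentBundle (𝓡 n) M ↦ inner ℝ v.2 v.2) :=
    ContMDiff.inner_bundle (b := fun v : TangentBundle (𝓡 n) M ↦ v.1)
      (v := fun v ↦ v.2) (w := fun v ↦ v.2) contMDiff_id contMDiff_id
  have h2 := (h1.continuous.sqrt.comp_aestronglyMeasurable hG).enorm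
  refine h2.congr (Eventually.of_forall fun x ↦ ?_)
  change ‖√(inner ℝ (G x) (G x))‖ₑ = ‖G x‖ₑ
  rw [real_inner_self_eq_norm_sq, Real.sqrt_sq (norm_nonneg _), enorm_norm]

variable [MeasurableSpace M] [BorelSpace M]

/-- Approximate by test functions and use `(a + b)^p ≤ 2^(p-1) (a^p + b^p)` once for the functions
and once for the gradients. The lost factors are harmless, since only a finite constant is needed.
-/
theorem lintegral_rpow_le_of_memW01p {p : ℝ} (hp : 1 ≤ p) {c : ℝ≥0∞} (hc : c ≠ ⊤)
    (hle : ∀ φ : M → ℝ, ContMDiff (𝓡 n) 𝓘(ℝ, ℝ) 1 φ → HasCompactSupport φ →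
      ∫⁻ x, ‖φ x‖ₑ ^ p ∂riemVolume n M ≤ c * ∫⁻ x, ‖grad n φ x‖ₑ ^ p ∂riemVolume n M)
    {v : M → ℝ} {G : ∀ x : M, TangentSpace (𝓡 n) x} (hv : MemW01p n p v G) :
    ∫⁻ x, ‖v x‖ₑ ^ p ∂riemVolume n M ≤
      2 ^ (p - 1) * (c * (2 ^ (p - 1) * ∫⁻ x, ‖G x‖ₑ ^ p ∂riemVolume n M)) := by
  obtain ⟨hW, φ, hφ, hlim⟩ := hv
  set μ := riemVolume n M
  set D : ℝ≥0∞ := 2 ^ (p - 1) with hD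
  have hDt : D ≠ ⊤ := ENNReal.rpow_ne_top_of_nonneg (by linarith) ENNReal.ofNat_ne_top
  set ε : ℕ → ℝ≥0∞ := fun k ↦ ∫⁻ x, ‖φ k x - v x‖ₑ ^ p ∂μ +
    ∫⁻ x, ‖grad n (φ k) x - G x‖ₑ ^ p ∂μ with hε
  have hGm := (aemeasurable_enorm_of_aestronglyMeasurable hW.aestronglyMeasurable_grad).pow_const p
  have b1 : ∀ k, ∫⁻ x, ‖v x‖ₑ ^ p ∂μ ≤ D * (ε k + ∫⁻ x, ‖φ k x‖ₑ ^ p ∂μ) := fun k ↦ by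
    have hm : AEMeasurable (fun x ↦ ‖φ k x‖ₑ ^ p) μ :=
      ((hφ k).1.continuous.measurable.enorm.pow_const p).aemeasurable
    calc ∫⁻ x, ‖v x‖ₑ ^ p ∂μ ≤ ∫⁻ x, D * (‖φ k x - v x‖ₑ ^ p + ‖φ k x‖ₑ ^ p) ∂μ := by
          refine lintegral_mono fun x ↦ ?_
          refine le_trans ?_ (ENNReal.rpow_add_le_mul_rpow_add_rpow _ _ hp)
          refine ENNReal.rpow_le_rpow ?_ (by linarith)
          have := enorm_sub_le (a := φ k x) (b := φ k x - v x)
          rw [sub_sub_cancel] at this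
          rwa [add_comm]
      _ = D * (∫⁻ x, ‖φ k x - v x‖ₑ ^ p ∂μ + ∫⁻ x, ‖φ k x‖ₑ ^ p ∂μ) := by
          rw [lintegral_const_mul' _ _ hDt, lintegral_add_right' _ hm]
      _ ≤ _ := by gcongr; exact le_self_add
  have b2 : ∀ k, ∫⁻ x, ‖grad n (φ k) x‖ₑ ^ p ∂μ ≤ D * (ε k + ∫⁻ x, ‖G x‖ₑ ^ p ∂μ) := fun k ↦ by
    calc ∫⁻ x, ‖grad n (φ k) x‖ₑ ^ p ∂μ
        ≤ ∫⁻ x, D * (‖grad n (φ k) x - G x‖ₑ ^ p + ‖G x‖ₑ ^ p) ∂μ := by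
          refine lintegral_mono fun x ↦ ?_
          refine le_trans ?_ (ENNReal.rpow_add_le_mul_rpow_add_rpow _ _ hp)
          refine ENNReal.rpow_le_rpow ?_ (by linarith)
          simpa using enorm_add_le (grad n (φ k) x - G x) (G x)
      _ = D * (∫⁻ x, ‖grad n (φ k) x - G x‖ₑ ^ p ∂μ + ∫⁻ x, ‖G x‖ₑ ^ p ∂μ) := by
          -- Measurability of one summand suffices to split the integral, so none is needed for the
          -- difference of the two fields.
          rw [lintegral_const_mul' _ _ hDt, lintegral_add_right' _ hGm]
      _ ≤ _ := by gcongr; exact le_add_self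
  have b3 : ∀ k, ∫⁻ x, ‖v x‖ₑ ^ p ∂μ ≤
      D * (ε k + c * (D * (ε k + ∫⁻ x, ‖G x‖ₑ ^ p ∂μ))) := fun k ↦
    (b1 k).trans (by
      gcongr
      exact (hle _ ((hφ k).1.of_le (by simp)) (hφ k).2).trans (by gcongr; exact b2 k))
  have hl : Tendsto (fun k ↦ D * (ε k + c * (D * (ε k + ∫⁻ x, ‖G x‖ₑ ^ p ∂μ)))) atTop
      (𝓝 (D * (0 + c * (D * (0 + ∫⁻ x, ‖G x‖ₑ ^ p ∂μ))))) :=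
    ENNReal.Tendsto.const_mul (hlim.add (ENNReal.Tendsto.const_mul (ENNReal.Tendsto.const_mul
      (hlim.add tendsto_const_nhds) (Or.inr hDt)) (Or.inr hc))) (Or.inr hDt)
  simpa using ge_of_tendsto' hl b3

variable [T2Space M] [SecondCountableTopology M]

/-- The divergence theorem for the flux, tested against `w = |φ|^p e^u`. The bounds `e^(-C) ≤ e^u ≤
e^C` then remove `u` from both sides. -/
theorem mul_integral_abs_rpow_le {p : ℝ} (hp : 2 ≤ p) {u : M → ℝ}
    (hu : ContMDiff (𝓡 n) 𝓘(ℝ, ℝ) 2 u) {k : ℝ} (hk : 0 < k) (hΔ : ∀ x, k ≤ pLaplacian n p u x)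
    {C : ℝ} (hC : ∀ x, |u x| ≤ C) {φ : M → ℝ} (hφ : ContMDiff (𝓡 n) 𝓘(ℝ, ℝ) 1 φ)
    (hφc : HasCompactSupport φ) :
    k * Real.exp (-C) * ∫ y, |φ y| ^ p ∂riemVolume n M ≤
      p ^ p * Real.exp C * ∫ y, ‖grad n φ y‖ ^ p ∂riemVolume n M := by
  have hp0 : p ≠ 0 := by linarith
  have hp1 : 0 ≤ p := by linarith
  set V : ∀ y : M, TangentSpace (𝓡 n) y := fun y ↦ ‖grad n u y‖ ^ (p - 2) • grad n u y with hV
  have hVC : HasC1Components V := fun x j ↦ contDiffOn_coordComp_rpow_grad hp x hu j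
  set w : M → ℝ := fun y ↦ |φ y| ^ p * Real.exp (u y) with hw
  have hw1 : ContMDiff (𝓡 n) 𝓘(ℝ, ℝ) 1 w := by
    have h1 : ContMDiff (𝓡 n) 𝓘(ℝ, ℝ) 1 fun y ↦ |φ y| ^ p :=
      (contDiff_norm_rpow (E := ℝ) (show 1 < p by linarith)).contMDiff.comp hφ
    exact h1.mul (Real.contDiff_exp.contMDiff.comp (hu.of_le one_le_two))
  have hφ0 : ∀ y ∉ tsupport φ, |φ y| ^ p = 0 := fun y hy ↦ by
    rw [image_eq_zero_of_notMem_tsupport hy, abs_zero, Real.zero_rpow hp0]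
  have hwc : HasCompactSupport w := HasCompactSupport.intro hφc fun y hy ↦ by
    simp only [hw, hφ0 y hy, zero_mul]
  have key := integral_mul_divergence hVC hw1 hwc
  have hgc := continuous_norm_grad hφ
  have hφa : Continuous fun y ↦ |φ y| ^ p := hφ.continuous.abs.rpow_const fun _ ↦ Or.inr hp1
  have i1 : Integrable (fun y ↦ |φ y| ^ p) (riemVolume n M) :=
    hφa.integrable_of_hasCompactSupport (HasCompactSupport.intro hφc hφ0)
  have i2 : Integrable (fun y ↦ ‖grad n φ y‖ ^ p) (riemVolume n M) :=
    (hgc.rpow_const fun _ ↦ Or.inr hp1).integrable_of_hasCompactSupport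
      (HasCompactSupport.intro hφc fun y hy ↦ by
        rw [grad_eq_zero_of_notMem_tsupport hy, norm_zero, Real.zero_rpow hp0])
  have i3 : Integrable (fun y ↦ w y * divergence n V y) (riemVolume n M) :=
    (hw1.continuous.fun_mul (continuous_divergence hVC)).integrable_of_hasCompactSupport
      (hwc.mul_right (f' := divergence n V))
  have i4 : Integrable (fun y ↦ inner ℝ (grad n w y) (V y)) (riemVolume n M) :=
    (continuous_inner_grad hw1 fun x i ↦
      (hVC x i).continuousOn).integrable_of_hasCompactSupport
      (HasCompactSupport.intro hwc fun y hy ↦ by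
        rw [grad_eq_zero_of_notMem_tsupport hy, inner_zero_left])
  calc k * Real.exp (-C) * ∫ y, |φ y| ^ p ∂riemVolume n M
      = ∫ y, k * Real.exp (-C) * |φ y| ^ p ∂riemVolume n M := (integral_const_mul _ _).symm
    _ ≤ ∫ y, w y * divergence n V y ∂riemVolume n M := by
        refine integral_mono (i1.const_mul _) i3 fun y ↦ ?_
        have h1 : Real.exp (-C) ≤ Real.exp (u y) :=
          Real.exp_le_exp.2 (abs_le.1 (hC y)).1
        calc k * Real.exp (-C) * |φ y| ^ p = (|φ y| ^ p * Real.exp (-C)) * k := by ring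
          _ ≤ (|φ y| ^ p * Real.exp (u y)) * divergence n V y := by
              gcongr
              exact hΔ y
    _ = ∫ y, -inner ℝ (grad n w y) (V y) ∂riemVolume n M := by rw [key, integral_neg]
    _ ≤ ∫ y, p ^ p * Real.exp C * ‖grad n φ y‖ ^ p ∂riemVolume n M := by
        refine integral_mono i4.neg (i2.const_mul _) fun y ↦ ?_
        refine (neg_inner_grad_rpow_mul_exp_le hp (hu.mdifferentiable (by simp) y)
          (hφ.mdifferentiable one_ne_zero y)).trans ?_
        have h1 : Real.exp (u y) ≤ Real.exp C :=
          Real.exp_le_exp.2 (abs_le.1 (hC y)).2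
        rw [mul_assoc]
        gcongr
    _ = _ := integral_const_mul _ _

theorem exists_lintegral_rpow_le {p : ℝ} (hp : 2 ≤ p) {u : M → ℝ}
    (hu : StronglyPSubharmonic n p u) (hb : Bornology.IsBounded (Set.range u)) :
    ∃ c : ℝ≥0∞, c ≠ ⊤ ∧ ∀ φ : M → ℝ, ContMDiff (𝓡 n) 𝓘(ℝ, ℝ) 1 φ → HasCompactSupport φ →
      ∫⁻ x, ‖φ x‖ₑ ^ p ∂riemVolume n M ≤ c * ∫⁻ x, ‖grad n φ x‖ₑ ^ p ∂riemVolume n M := by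
  obtain ⟨hu2, k, hk, hΔ⟩ := hu
  obtain ⟨C, hC⟩ := isBounded_iff_forall_norm_le.1 hb
  have hp1 : 0 ≤ p := by linarith
  have hp0 : p ≠ 0 := by linarith
  refine ⟨ENNReal.ofReal ((k * Real.exp (-C))⁻¹ * (p ^ p * Real.exp C)), ENNReal.ofReal_ne_top,
    fun φ hφ hφc ↦ ?_⟩
  have h := mul_integral_abs_rpow_le hp hu2 hk hΔ (fun x ↦ hC _ ⟨x, rfl⟩) hφ hφc
  have i1 : Integrable (fun y ↦ |φ y| ^ p) (riemVolume n M) :=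
    (hφ.continuous.abs.rpow_const fun _ ↦ Or.inr hp1).integrable_of_hasCompactSupport
      (HasCompactSupport.intro hφc fun y hy ↦ by
        rw [image_eq_zero_of_notMem_tsupport hy, abs_zero, Real.zero_rpow hp0])
  have i2 : Integrable (fun y ↦ ‖grad n φ y‖ ^ p) (riemVolume n M) :=
    ((continuous_norm_grad hφ).rpow_const fun _ ↦ Or.inr hp1).integrable_of_hasCompactSupport
      (HasCompactSupport.intro hφc fun y hy ↦ by
        rw [grad_eq_zero_of_notMem_tsupport hy, norm_zero, Real.zero_rpow hp0])
  have e1 : ∫⁻ x, ‖φ x‖ₑ ^ p ∂riemVolume n M =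
      ENNReal.ofReal (∫ x, |φ x| ^ p ∂riemVolume n M) := by
    rw [ofReal_integral_eq_lintegral_ofReal i1 (Eventually.of_forall fun _ ↦ by positivity)]
    refine lintegral_congr fun x ↦ ?_
    rw [← ENNReal.ofReal_rpow_of_nonneg (abs_nonneg _) hp1, ← Real.norm_eq_abs, ofReal_norm]
  have e2 : ∫⁻ x, ‖grad n φ x‖ₑ ^ p ∂riemVolume n M =
      ENNReal.ofReal (∫ x, ‖grad n φ x‖ ^ p ∂riemVolume n M) := by
    rw [ofReal_integral_eq_lintegral_ofReal i2 (Eventually.of_forall fun _ ↦ by positivity)]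
    refine lintegral_congr fun x ↦ ?_
    rw [← ENNReal.ofReal_rpow_of_nonneg (norm_nonneg _) hp1, ofReal_norm]
  rw [e1, e2, ← ENNReal.ofReal_mul (by positivity)]
  refine ENNReal.ofReal_le_ofReal ?_
  rw [mul_assoc, ← div_eq_inv_mul, le_div_iff₀ (by positivity), mul_comm]
  exact h

theorem firstEigenvalue_ne_zero {p : ℝ} (hp : 2 ≤ p) {u : M → ℝ}
    (hu : StronglyPSubharmonic n p u) (hb : Bornology.IsBounded (Set.range u)) :
    firstEigenvalue n M p ≠ 0 := by
  obtain ⟨c, hc, hle⟩ := exists_lintegral_rpow_le hp hu hb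
  set D : ℝ≥0∞ := 2 ^ (p - 1) with hD
  have hDt : D ≠ ⊤ := ENNReal.rpow_ne_top_of_nonneg (by linarith) ENNReal.ofNat_ne_top
  have hct : D * c * D ≠ ⊤ := ENNReal.mul_ne_top (ENNReal.mul_ne_top hDt hc) hDt
  have hpos : 0 < (D * c * D)⁻¹ := ENNReal.inv_pos.2 hct
  refine (hpos.trans_le ?_).ne'
  refine le_iInf fun v ↦ le_iInf fun G ↦ le_iInf fun hv ↦ le_iInf fun hv0 ↦ ?_
  have h := lintegral_rpow_le_of_memW01p (by linarith) hc hle hv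
  have hp0 : 0 < p := by linarith
  -- The denominator of the quotient is neither `0` nor `⊤`, so the `ℝ≥0∞` division can be cleared.
  have hI0 : ∫⁻ x, ‖v x‖ₑ ^ p ∂riemVolume n M ≠ 0 := by
    intro h0
    rw [lintegral_eq_zero_iff' (hv.1.memLp.1.enorm.pow_const p)] at h0
    apply hv0
    filter_upwards [h0] with x hx
    simpa [hp0, hp0.not_gt, hp0.ne'] using hx
  have hIt : ∫⁻ x, ‖v x‖ₑ ^ p ∂riemVolume n M ≠ ⊤ := by
    have := lintegral_rpow_enorm_lt_top_of_eLpNorm_lt_top (by simpa using hp0)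
      ENNReal.ofReal_ne_top hv.1.memLp.2
    rw [ENNReal.toReal_ofReal hp0.le] at this
    exact this.ne
  rw [ENNReal.le_div_iff_mul_le (Or.inl hI0) (Or.inl hIt)]
  calc (D * c * D)⁻¹ * ∫⁻ x, ‖v x‖ₑ ^ p ∂riemVolume n M
      ≤ (D * c * D)⁻¹ * ((D * c * D) * ∫⁻ x, ‖G x‖ₑ ^ p ∂riemVolume n M) := by
        gcongr
        exact h.trans_eq (by ring)
    _ ≤ 1 * ∫⁻ x, ‖G x‖ₑ ^ p ∂riemVolume n M := by
        rw [← mul_assoc]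
        gcongr
        exact ENNReal.inv_mul_le_one _
    _ = _ := one_mul _

end Eigenvalue
end PLap

end

theorem theorem1p1 (n : ℕ) (M : Type*) [EMetricSpace M] [SecondCountableTopology M]
    [ChartedSpace (EuclideanSpace ℝ (Fin n)) M] [IsManifold (𝓡 n) ∞ M]
    [RiemannianBundle (fun x : M ↦ TangentSpace (𝓡 n) x)]
    [IsContMDiffRiemannianBundle (𝓡 n) ∞ (EuclideanSpace ℝ (Fin n))
      (fun x : M ↦ TangentSpace (𝓡 n) x)]
    [IsRiemannianManifold (𝓡 n) M]
    [MeasurableSpace M] [BorelSpace M]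
    [CompleteSpace M] [NoncompactSpace M]
    (p : ℝ) (hp : 2 ≤ p) (hlam : PLap.firstEigenvalue n M p = 0)
    (u : M → ℝ) (hu : PLap.StronglyPSubharmonic n p u) :
    ¬ Bornology.IsBounded (Set.range u) := fun hb ↦
  PLap.firstEigenvalue_ne_zero hp hu hb hlam
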